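/- Let $k,l\ge 0$ be integers. A $(k,l)$-parking function of length $n$ is a word $a=a_1\cdots a_n$ over the alphabet $\{1,\dots,l+(n-1)k\}$ whose nondecreasing rearrangement $a^\uparrow$ satisfies $a^\uparrow_i\le l+(i-1)k$ for $1\le i\le n$; let $\mathrm{PF}^{(k,l)}_n$ be the set of these words, and put $\|a\|=\sum_i (a_i-1)$. Let $H_n(0)$ be the $0$-Hecke algebra over $\mathbb C$, with generators $T_1,\dots,T_{n-1}$, the braid relations and $T_i^2=-T_i$. It acts on the right on the vector space with basis the words of length $n$ over the nonnegative integers: $w\cdot T_i$ is the word obtained from $w$ by exchanging its $i$-th and $(i+1)$-st letters if $w_i<w_{i+1}$, it is $0$ if $w_i=w_{i+1}$, and it is $-w$ if $w_i>w_{i+1}$. Let $M^{(k,l)}_{n,d}$ be the submodule with basis $\{a\in \mathrm{PF}^{(k,l)}_n : \|a\|=d\}$. Let $\mathbf{Sym}$ be the algebra of noncommutative symmetric functions, i.e. the free associative algebra on $S_1,S_2,\dots$ (with $S_0=1$), with coefficients in $\mathbb C[q,q^{-1}]$, and let $R_I$ be its ribbon basis, so that $S^I=S_{i_1}\cdots S_{i_r}=\sum_J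 R_J$, summed over the compositions $J$ coarser than or equal to $I$. The noncommutative characteristic of a finite-dimensional projective right $H_n(0)$-module $M$ is $\mathbf{ch}(M)=\sum_{I\vDash n}\dim\operatorname{Hom}_{H_n(0)}(M,C_I)\,R_I$. Here $C_I$ is the one-dimensional module on which $T_i$ acts by $-1$ if $i$ is in the descent set $\{i_1,i_1+i_2,\dots\}\subseteq\{1,\dots,n-1\}$ of $I$, and by $0$ otherwise; equivalently, $\mathbf{ch}$ is additive and sends the projective cover of $C_I$ to $R_I$. The $q$-characteristic is $$\mathbf{ch}_q\,\mathrm{PF}^{(k,l)}_n=\sum_{d\ge 0}q^d\,\mathbf{ch}\bigl(M^{(k,l)}_{n,d}\bigr).$$ Let $\sigma_t(q^iA)=\sum_{n\ge0}t^nq^{in}S_n$. For $m\in\mathbb Z$ define $S_n([m]_qA)$ by $\sum_{n\ge0}t^nS_n([m]_qA)=\sigma_t(A)\sigma_t(qA)\cdots\sigma_t(q^{m-1}A)$ if $m\ge 0$, and $=\bigl(\sigma_t(q^{m}A)\cdots\sigma_t(q^{-2}A)\sigma_t(q^{-1}A)\bigr)^{-1}$ if $m<0$. For $r\in\mathbb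 Z$ put $$F_k^{(r)}(x,q;A)=\sum_{n\ge0}x^nq^{-k\binom{n+1}{2}}S_n([nk+r]_qA),$$ a power series in the central variable $x$ with coefficients in $\mathbf{Sym}$. Then for every $r\in\mathbb Z$ the series $F_k^{(r-l)}(q^lx,q;A)$ is invertible, and $$\sum_{n\ge0}x^nq^{-k\binom{n+1}{2}}\,\mathbf{ch}_q\,\mathrm{PF}^{(k,l)}_n=F_k^{(r)}(x,q;A)\,F_k^{(r-l)}(q^lx,q;A)^{-1}.$$ -/

import Mathlib

noncomputable section

/-! ### The 0-Hecke algebra and its modules -/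

/-- Defining relations of the 0-Hecke algebra on generators `T_1, …, T_{n-1}`. The generator
`T_{i+1}` of the literature is indexed by `i : Fin (n - 1)`. The quadratic relation
`T ^ 2 = -T` is the one satisfied by the action on words below. -/
inductive HeckeZeroRel (n : ℕ) :
    FreeAlgebra ℂ (Fin (n - 1)) → FreeAlgebra ℂ (Fin (n - 1)) → Prop
  | quadratic (i : Fin (n - 1)) :
      HeckeZeroRel n (FreeAlgebra.ι ℂ i * FreeAlgebra.ι ℂ i) (-FreeAlgebra.ι ℂ i)
  | braid (i j : Fin (n - 1)) (h : (j : ℕ) = i + 1) :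
      HeckeZeroRel n (FreeAlgebra.ι ℂ i * FreeAlgebra.ι ℂ j * FreeAlgebra.ι ℂ i)
        (FreeAlgebra.ι ℂ j * FreeAlgebra.ι ℂ i * FreeAlgebra.ι ℂ j)
  | comm (i j : Fin (n - 1)) (h : (i : ℕ) + 1 < j) :
      HeckeZeroRel n (FreeAlgebra.ι ℂ i * FreeAlgebra.ι ℂ j)
        (FreeAlgebra.ι ℂ j * FreeAlgebra.ι ℂ i)

/-- The 0-Hecke algebra `H_n(0)` over `ℂ`. -/
abbrev HeckeZero (n : ℕ) : Type := RingQuot (HeckeZeroRel n)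

/-- The generators `T_i` of `H_n(0)`. -/
def heckeT (n : ℕ) (i : Fin (n - 1)) : HeckeZero n :=
  RingQuot.mkAlgHom ℂ (HeckeZeroRel n) (FreeAlgebra.ι ℂ i)

/-- The character of `H_n(0)` sending `T_i` to `-1` if `i ∈ D` and to `0` otherwise. The
one-dimensional modules given by these characters are all the simple `H_n(0)`-modules. -/
def heckeChar (n : ℕ) (D : Finset (Fin (n - 1))) : HeckeZero n →ₐ[ℂ] ℂ :=
  RingQuot.liftAlgHom ℂ ⟨FreeAlgebra.lift ℂ fun i => if i ∈ D then (-1 : ℂ) else 0, by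
    intro x y h
    cases h with
    | quadratic i => simp
    | braid i j h => simp only [map_mul, FreeAlgebra.lift_ι_apply]; split_ifs <;> simp
    | comm i j h => simp only [map_mul, FreeAlgebra.lift_ι_apply]; ring⟩

/-- The space `Hom_{H_n(0)}(M, C_D)` of homomorphisms from a right `H_n(0)`-module `M` to the
one-dimensional simple module `C_D` with character `heckeChar n D`. -/
def homToSimple (n : ℕ) (M : Type*) [AddCommGroup M] [Module ℂ M]
    [Module (HeckeZero n)ᵐᵒᵖ M] (D : Finset (Fin (n - 1))) :
    Submodule ℂ (Module.Dual ℂ M) where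
  carrier := {f | ∀ (h : HeckeZero n) (x : M), f (MulOpposite.op h • x) = heckeChar n D h * f x}
  add_mem' := by
    intro f g hf hg h x
    simp [hf h x, hg h x, mul_add]
  zero_mem' := by
    intro h x
    simp
  smul_mem' := by
    intro c f hf h x
    simp [hf h x, mul_left_comm]

/-! ### Noncommutative symmetric functions -/

/-- The coefficient ring `ℂ[q, q⁻¹]`. The power `q ^ m`, `m : ℤ`, is `LaurentPolynomial.T m`. -/
abbrev QRing : Type := LaurentPolynomial ℂ

/-- The power `q ^ m` of the indeterminate `q`. -/
abbrev qpow (m : ℤ) : QRing := LaurentPolynomial.T m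

/-- Noncommutative symmetric functions with coefficients in `ℂ[q, q⁻¹]`: the free associative
algebra on generators `S_1, S_2, …`. -/
abbrev NSym : Type := FreeAlgebra QRing ℕ+

/-- The complete functions `S_n`, with `S_0 = 1`. -/
def completeS (n : ℕ) : NSym :=
  if h : 0 < n then FreeAlgebra.ι QRing ⟨n, h⟩ else 1

/-- `S^I = S_{i_1} ⋯ S_{i_r}`. -/
def completeSI {n : ℕ} (I : Composition n) : NSym :=
  (I.blocks.map completeS).prod

/-- The descent set `{i_1, i_1 + i_2, …} ⊆ {1, …, n-1}` of a composition, with `j + 1`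
represented by `j : Fin (n - 1)`. -/
def compDescents {n : ℕ} (I : Composition n) : Finset (Fin (n - 1)) :=
  compositionAsSetEquiv n (compositionEquiv n I)

/-- The ribbon functions `R_I = ∑_J (-1)^{ℓ(I)-ℓ(J)} S^J`, the sum being over the compositions
`J` that are coarser than or equal to `I`. -/
def ribbonR {n : ℕ} (I : Composition n) : NSym :=
  ∑ J : Composition n with compDescents J ⊆ compDescents I,
    (-1) ^ (I.length + J.length) * completeSI J

/-- The noncommutative characteristic of a finite-dimensional projective right
`H_n(0)`-module `M`. It is additive and sends the indecomposable projective module `P_I`, the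
projective cover of the simple module `C_I`, to `R_I`. The multiplicity of `P_I` as a direct
summand of `M` is `dim Hom(M, C_I)`. -/
def heckeCh (n : ℕ) (M : Type*) [AddCommGroup M] [Module ℂ M]
    [Module (HeckeZero n)ᵐᵒᵖ M] : NSym :=
  ∑ I : Composition n, Module.finrank ℂ (homToSimple n M (compDescents I)) • ribbonR I

/-! ### The action of the 0-Hecke algebra on words -/

/-- The position `i` (zero-based) of a word of length `n`. -/
def posL {n : ℕ} (i : Fin (n - 1)) : Fin n := ⟨i, by omega⟩

/-- The position `i + 1` (zero-based) of a word of length `n`. -/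
def posR {n : ℕ} (i : Fin (n - 1)) : Fin n := ⟨i + 1, by omega⟩

/-- The word `w · σ_i`, obtained by exchanging the letters in positions `i` and `i + 1`. -/
def swapAt {n : ℕ} (i : Fin (n - 1)) (w : Fin n → ℕ) : Fin n → ℕ :=
  w ∘ Equiv.swap (posL i) (posR i)

/-- The space with basis the words of length `n` on nonnegative integers. -/
def WordModule (n : ℕ) : Type := (Fin n → ℕ) →₀ ℂ

instance (n : ℕ) : AddCommGroup (WordModule n) :=
  inferInstanceAs (AddCommGroup ((Fin n → ℕ) →₀ ℂ))

instance (n : ℕ) : Module ℂ (WordModule n) :=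
  inferInstanceAs (Module ℂ ((Fin n → ℕ) →₀ ℂ))

/-- A word as a basis element. -/
def wordBasis {n : ℕ} (w : Fin n → ℕ) : WordModule n := Finsupp.single w (1 : ℂ)

/-- `w · T_i` for a word `w`. -/
def wordT {n : ℕ} (i : Fin (n - 1)) (w : Fin n → ℕ) : WordModule n :=
  if w (posL i) < w (posR i) then wordBasis (swapAt i w)
  else if w (posL i) = w (posR i) then 0
  else -wordBasis w

/-- The linear operator `x ↦ x · T_i`. -/
def opT {n : ℕ} (i : Fin (n - 1)) : Module.End ℂ (WordModule n) :=
  Finsupp.linearCombination ℂ (wordT i)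

theorem opT_wordBasis {n : ℕ} (i : Fin (n - 1)) (w : Fin n → ℕ) :
    opT i (wordBasis w) = wordT i w := by
  unfold opT wordBasis
  erw [Finsupp.linearCombination_single]
  exact one_smul _ _

theorem wordModule_end_ext {n : ℕ} {f g : Module.End ℂ (WordModule n)}
    (h : ∀ w, f (wordBasis w) = g (wordBasis w)) : f = g := by
  apply Finsupp.lhom_ext'
  intro w
  ext
  exact h w

theorem swapAt_posL {n : ℕ} (i : Fin (n - 1)) (w : Fin n → ℕ) :
    swapAt i w (posL i) = w (posR i) := by
  simp [swapAt]

theorem swapAt_posR {n : ℕ} (i : Fin (n - 1)) (w : Fin n → ℕ) :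
    swapAt i w (posR i) = w (posL i) := by
  simp [swapAt]

theorem swapAt_of_ne {n : ℕ} (i : Fin (n - 1)) (w : Fin n → ℕ) {p : Fin n}
    (h1 : p ≠ posL i) (h2 : p ≠ posR i) : swapAt i w p = w p := by
  simp [swapAt, Equiv.swap_apply_of_ne_of_ne h1 h2]

theorem opT_quadratic {n : ℕ} (i : Fin (n - 1)) :
    (opT i * opT i : Module.End ℂ (WordModule n)) = -opT i := by
  apply wordModule_end_ext
  intro w
  rw [Module.End.mul_apply, LinearMap.neg_apply, opT_wordBasis, wordT]
  split_ifs with h1 h2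
  · rw [opT_wordBasis, wordT, swapAt_posL, swapAt_posR, if_neg (by omega), if_neg (by omega)]
  · simp
  · rw [map_neg, opT_wordBasis, wordT, if_neg h1, if_neg h2]

theorem opT_comm {n : ℕ} (i j : Fin (n - 1)) (h : (i : ℕ) + 1 < j) :
    (opT i * opT j : Module.End ℂ (WordModule n)) = opT j * opT i := by
  have a1 : (posL i : Fin n) ≠ posL j := by simp only [posL, ne_eq, Fin.mk.injEq]; omega
  have a2 : (posL i : Fin n) ≠ posR j := by simp only [posL, posR, ne_eq, Fin.mk.injEq]; omega
  have a3 : (posR i : Fin n) ≠ posL j := by simp only [posL, posR, ne_eq, Fin.mk.injEq]; omega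
  have a4 : (posR i : Fin n) ≠ posR j := by simp only [posR, ne_eq, Fin.mk.injEq]; omega
  have hs : ∀ w : Fin n → ℕ, swapAt i (swapAt j w) = swapAt j (swapAt i w) := by
    intro w
    funext p
    simp only [swapAt, Function.comp_apply, Equiv.swap_apply_def]
    congr 1
    split_ifs <;> simp_all
  apply wordModule_end_ext
  intro w
  rw [Module.End.mul_apply, Module.End.mul_apply, opT_wordBasis, opT_wordBasis]
  have e1 := swapAt_of_ne i w a1.symm a3.symm
  have e2 := swapAt_of_ne i w a2.symm a4.symm
  have e3 := swapAt_of_ne j w a1 a2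
  have e4 := swapAt_of_ne j w a3 a4
  unfold wordT
  split_ifs <;> simp only [map_neg, map_zero, opT_wordBasis, wordT, *,
    if_true, if_false, neg_zero, lt_irrefl]

theorem opT_braid {n : ℕ} (i j : Fin (n - 1)) (h : (j : ℕ) = i + 1) :
    (opT i * opT j * opT i : Module.End ℂ (WordModule n)) = opT j * opT i * opT j := by
  have hp : (posL j : Fin n) = posR i := by simp [posL, posR, h]
  have a1 : (posL i : Fin n) ≠ posR i := by simp [posL, posR]
  have a2 : (posL i : Fin n) ≠ posR j := by simp only [posL, posR, ne_eq, Fin.mk.injEq]; omega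
  have a3 : (posR i : Fin n) ≠ posR j := by simp only [posR, ne_eq, Fin.mk.injEq]; omega
  have hs : ∀ w : Fin n → ℕ,
      swapAt i (swapAt j (swapAt i w)) = swapAt j (swapAt i (swapAt j w)) := by
    intro w
    funext p
    simp only [swapAt, Function.comp_apply, Equiv.swap_apply_def, hp]
    congr 1
    split_ifs <;> simp_all
  have i1 : ∀ w : Fin n → ℕ, swapAt i w (posL i) = w (posR i) := swapAt_posL i
  have i2 : ∀ w : Fin n → ℕ, swapAt i w (posR i) = w (posL i) := swapAt_posR i
  have i3 : ∀ w : Fin n → ℕ, swapAt i w (posR j) = w (posR j) :=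
    fun w => swapAt_of_ne i w a2.symm a3.symm
  have j1 : ∀ w : Fin n → ℕ, swapAt j w (posL i) = w (posL i) :=
    fun w => swapAt_of_ne j w (hp ▸ a1) a2
  have j2 : ∀ w : Fin n → ℕ, swapAt j w (posR i) = w (posR j) :=
    fun w => hp ▸ swapAt_posL j w
  have j3 : ∀ w : Fin n → ℕ, swapAt j w (posR j) = w (posR i) :=
    fun w => hp ▸ swapAt_posR j w
  have ti1 : ∀ w : Fin n → ℕ, w (posL i) < w (posR i) →
      opT i (wordBasis w) = wordBasis (swapAt i w) := by
    intro w hw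
    rw [opT_wordBasis, wordT, if_pos hw]
  have ti2 : ∀ w : Fin n → ℕ, w (posL i) = w (posR i) → opT i (wordBasis w) = 0 := by
    intro w hw
    rw [opT_wordBasis, wordT, if_neg (by omega), if_pos hw]
  have ti3 : ∀ w : Fin n → ℕ, w (posR i) < w (posL i) →
      opT i (wordBasis w) = -wordBasis w := by
    intro w hw
    rw [opT_wordBasis, wordT, if_neg (by omega), if_neg (by omega)]
  have tj1 : ∀ w : Fin n → ℕ, w (posR i) < w (posR j) →
      opT j (wordBasis w) = wordBasis (swapAt j w) := by
    intro w hw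
    rw [opT_wordBasis, wordT, hp, if_pos hw]
  have tj2 : ∀ w : Fin n → ℕ, w (posR i) = w (posR j) → opT j (wordBasis w) = 0 := by
    intro w hw
    rw [opT_wordBasis, wordT, hp, if_neg (by omega), if_pos hw]
  have tj3 : ∀ w : Fin n → ℕ, w (posR j) < w (posR i) →
      opT j (wordBasis w) = -wordBasis w := by
    intro w hw
    rw [opT_wordBasis, wordT, hp, if_neg (by omega), if_neg (by omega)]
  apply wordModule_end_ext
  intro w
  simp only [Module.End.mul_apply]
  rcases lt_trichotomy (w (posL i)) (w (posR i)) with h1 | h1 | h1 <;>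
  rcases lt_trichotomy (w (posR i)) (w (posR j)) with h2 | h2 | h2 <;>
  rcases lt_trichotomy (w (posL i)) (w (posR j)) with h3 | h3 | h3 <;>
  first
  | omega
  | simp (disch := first | omega | (simp only [i1, i2, i3, j1, j2, j3]; omega)) only
      [ti1, ti2, ti3, tj1, tj2, tj3, hs, map_neg, map_zero, neg_zero, neg_neg]

/-- The right action of `H_n(0)` on words, as an algebra homomorphism. -/
def wordRep (n : ℕ) : HeckeZero n →ₐ[ℂ] (Module.End ℂ (WordModule n))ᵐᵒᵖ :=
  RingQuot.liftAlgHom ℂ ⟨FreeAlgebra.lift ℂ fun i => MulOpposite.op (opT i), by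
    intro x y h
    cases h with
    | quadratic i =>
      simp only [map_mul, map_neg, FreeAlgebra.lift_ι_apply, ← MulOpposite.op_mul, opT_quadratic,
        MulOpposite.op_neg]
    | braid i j h =>
      simp only [map_mul, FreeAlgebra.lift_ι_apply, ← MulOpposite.op_mul, ← mul_assoc,
        opT_braid i j h]
    | comm i j h =>
      simp only [map_mul, FreeAlgebra.lift_ι_apply, ← MulOpposite.op_mul, opT_comm i j h]⟩

instance (n : ℕ) : Module (HeckeZero n)ᵐᵒᵖ (WordModule n) where
  smul h x := (wordRep n h.unop).unop x
  one_smul x := by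
    change (wordRep n 1).unop x = x
    simp
  mul_smul a b x := by
    change (wordRep n (b.unop * a.unop)).unop x
      = (wordRep n a.unop).unop ((wordRep n b.unop).unop x)
    simp
  smul_zero a := map_zero _
  smul_add a x y := map_add _ x y
  add_smul a b x := by
    change (wordRep n (a.unop + b.unop)).unop x
      = (wordRep n a.unop).unop x + (wordRep n b.unop).unop x
    simp
  zero_smul x := by
    change (wordRep n 0).unop x = 0
    simp

theorem op_smul_word {n : ℕ} (h : HeckeZero n) (x : WordModule n) :
    MulOpposite.op h • x = (wordRep n h).unop x := rfl

theorem op_heckeT_smul_wordBasis {n : ℕ} (i : Fin (n - 1)) (w : Fin n → ℕ) :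
    MulOpposite.op (heckeT n i) • wordBasis w = wordT i w := by
  rw [op_smul_word, ← opT_wordBasis]
  simp [wordRep, heckeT]

instance (n : ℕ) : IsScalarTower ℂ (HeckeZero n)ᵐᵒᵖ (WordModule n) where
  smul_assoc c h x := by
    change (wordRep n (c • h.unop)).unop x = c • (wordRep n h.unop).unop x
    simp

/-- A set of words is stable under rearrangement. -/
def RearrangementStable {n : ℕ} (W : Set (Fin n → ℕ)) : Prop :=
  ∀ w ∈ W, ∀ σ : Equiv.Perm (Fin n), w ∘ σ ∈ W

theorem opT_mem {n : ℕ} {W : Set (Fin n → ℕ)} (hW : RearrangementStable W)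
    (i : Fin (n - 1)) (x : WordModule n) (hx : x ∈ Submodule.span ℂ (wordBasis '' W)) :
    opT i x ∈ Submodule.span ℂ (wordBasis '' W) := by
  induction hx using Submodule.span_induction with
  | mem x h =>
    obtain ⟨w, hw, rfl⟩ := h
    rw [opT_wordBasis, wordT]
    split_ifs
    · exact Submodule.subset_span ⟨_, hW w hw _, rfl⟩
    · exact zero_mem _
    · exact neg_mem (Submodule.subset_span ⟨_, hw, rfl⟩)
  | zero => simp
  | add x y _ _ h1 h2 => rw [map_add]; exact add_mem h1 h2
  | smul c x _ h => rw [map_smul]; exact Submodule.smul_mem _ c h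

theorem smul_word_mem {n : ℕ} {W : Set (Fin n → ℕ)} (hW : RearrangementStable W)
    (h : HeckeZero n) (x : WordModule n) (hx : x ∈ Submodule.span ℂ (wordBasis '' W)) :
    MulOpposite.op h • x ∈ Submodule.span ℂ (wordBasis '' W) := by
  rw [op_smul_word]
  obtain ⟨a, rfl⟩ := RingQuot.mkAlgHom_surjective ℂ (HeckeZeroRel n) h
  have key : ∀ x ∈ Submodule.span ℂ (wordBasis '' W),
      (wordRep n (RingQuot.mkAlgHom ℂ (HeckeZeroRel n) a)).unop x ∈
        Submodule.span ℂ (wordBasis '' W) := by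
    induction a using FreeAlgebra.induction with
    | grade0 r =>
      intro x hx
      simpa [Algebra.algebraMap_eq_smul_one] using Submodule.smul_mem _ r hx
    | grade1 i =>
      intro x hx
      simpa [wordRep] using opT_mem hW i x hx
    | mul a b ha hb =>
      intro x hx
      simpa using hb _ (ha x hx)
    | add a b ha hb =>
      intro x hx
      simpa using add_mem (ha x hx) (hb x hx)
  exact key x hx

/-- The permutational `H_n(0)`-module on a rearrangement-stable set of words: the subspace of
the word module with basis this set. -/
def permModule {n : ℕ} (W : Set (Fin n → ℕ)) (hW : RearrangementStable W) :
    Submodule (HeckeZero n)ᵐᵒᵖ (WordModule n) where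
  carrier := Submodule.span ℂ (wordBasis '' W)
  add_mem' := add_mem
  zero_mem' := zero_mem _
  smul_mem' h x hx := smul_word_mem hW h.unop x hx

/-! ### `(k, l)`-parking functions -/

/-- The `(k, l)`-parking functions of length `n`: words `a` on `{1, …, l + (n - 1) k}` whose
nondecreasing rearrangement `a'` satisfies `a'_i ≤ l + (i - 1) k` for `1 ≤ i ≤ n`. Here
positions are zero-based. -/
def parkingFunctions (k l n : ℕ) : Finset (Fin n → ℕ) :=
  {a ∈ Fintype.piFinset fun _ : Fin n => Finset.Icc 1 (l + (n - 1) * k) |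
    ∀ i : Fin n, (a ∘ Tuple.sort a) i ≤ l + i * k}

/-- The statistic `‖w‖ = ∑ (a_i - 1)`, for words on positive integers. -/
def wordWeight {n : ℕ} (w : Fin n → ℕ) : ℕ := ∑ i, (w i - 1)

/-- The `(k, l)`-parking functions `w` with `‖w‖ = d`. -/
def parkingOfWeight (k l n d : ℕ) : Set (Fin n → ℕ) :=
  {w | w ∈ parkingFunctions k l n ∧ wordWeight w = d}

theorem parkingOfWeight_stable (k l n d : ℕ) :
    RearrangementStable (parkingOfWeight k l n d) := by
  rintro w ⟨hw, hd⟩ σ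
  simp only [parkingFunctions, Finset.mem_filter, Fintype.mem_piFinset] at hw
  refine ⟨?_, ?_⟩
  · simp only [parkingFunctions, Finset.mem_filter, Fintype.mem_piFinset]
    refine ⟨fun i => hw.1 (σ i), ?_⟩
    have : (w ∘ σ) ∘ Tuple.sort (w ∘ σ) = w ∘ Tuple.sort w :=
      Tuple.comp_perm_comp_sort_eq_comp_sort
    rw [this]
    exact hw.2
  · rw [← hd]
    exact Equiv.sum_comp σ fun i => w i - 1

/-- The `q`-characteristic `ch_q PF^{(k,l)}_n = ∑_d q^d ch(M_d)`, where `M_d` is the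
permutational module on the `(k, l)`-parking functions of weight `d`, the sum being over the
weights that occur. -/
def parkingChq (k l n : ℕ) : NSym :=
  ∑ d ∈ (parkingFunctions k l n).image wordWeight,
    qpow d • heckeCh n (permModule (parkingOfWeight k l n d) (parkingOfWeight_stable k l n d))

/-! ### Generating series -/

/-- `σ_t(q^i A) = ∑ t^n q^{in} S_n(A)`, a power series in `t`. -/
def sigmaQ (i : ℤ) : PowerSeries NSym :=
  PowerSeries.mk fun n => qpow (i * n) • completeS n

/-- `σ_t([m]_q A)` for `m : ℤ`. It is `σ_t(A) σ_t(qA) ⋯ σ_t(q^{m-1}A)` for `m ≥ 0`, and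
`(σ_t(q^{m}A) ⋯ σ_t(q^{-2}A) σ_t(q^{-1}A))⁻¹` for `m < 0`, in agreement with
`[m]_q = -(q^m + ⋯ + q^{-1})`. -/
def sigmaBracket : ℤ → PowerSeries NSym
  | Int.ofNat m => ((List.range m).map fun i : ℕ => sigmaQ i).prod
  | Int.negSucc m =>
      Ring.inverse ((List.range (m + 1)).map fun i : ℕ => sigmaQ ((i : ℤ) - (m + 1))).prod

/-- `S_n([m]_q A)`. -/
def completeBracket (n : ℕ) (m : ℤ) : NSym := PowerSeries.coeff n (sigmaBracket m)

/-- `F_k^{(r)}(x, q; A) = ∑ x^n q^{-k binom(n+1, 2)} S_n([nk + r]_q A)`, a power series in `x`. -/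
def parkingF (k : ℕ) (r : ℤ) : PowerSeries NSym :=
  PowerSeries.mk fun n =>
    qpow (-((k : ℤ) * ((n + 1).choose 2 : ℕ))) • completeBracket n (n * k + r)

/-- The substitution `x ↦ q^s x` in a power series in `x`. -/
def substQ (s : ℤ) (f : PowerSeries NSym) : PowerSeries NSym :=
  PowerSeries.mk fun n => qpow (s * n) • PowerSeries.coeff n f

end

noncomputable section

open Finset.HasAntidiagonal (antidiagonal mem_antidiagonal)

/-! ### The substitution `x ↦ q ^ s x` -/

/-! The proof multiplies out by the denominator and reduces the identity to unique factorisation of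
nondecreasing words.

On the module side, a form in `Hom(M, C_D)` is determined by its values on the nondecreasing words
`v` that ascend strictly at every position of `D`, and these values are arbitrary
(`finrank_homToSimple_permModule`). Hence `ch(M)` is the sum over nondecreasing `v` of the ribbons
`R_I` whose descent set lies in the ascent set of `v`. By Möbius inversion this inner sum is `S^I`,
where `I` lists the nonzero multiplicities of the letters of `v` (`heckeCh_permModule`,
`completeSI_ascents`). So `ch_q PF_n` becomes a sum `P_n` of monomials `q^{‖v‖} S^I` over
nondecreasing parking functions (`parkingChq_eq_parkingSum`).

On the series side, put `c_n = l + nk`. The coefficient of `t^N` in `σ_t([c_N]_q A)` sums the same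
monomials over all nondecreasing words of length `N` on `c_N` letters. Such a word splits uniquely
into its longest parking prefix, of length `a`, and a word on the letters beyond the first `c_a`
(`sum_multWeight_eq_sum_antidiagonal`). This gives `σ_t([L]_q A) = ∑ t^n P_n σ_t(q^{c_n}[L - c_n]_q
A)` in degree `N` for `L = c_N` only. Both sides are multiplied on the right by the same series when
`L` changes, so these special values force the identity for every integer `L`
(`coeff_sigmaBracket_eq_sum`). Taking `L = Nk + r` in degree `N` yields the theorem. -/

theorem qpow_smul_qpow_smul (a b : ℤ) (x : NSym) : qpow a • qpow b • x = qpow (a + b) • x := by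
  rw [smul_smul, ← LaurentPolynomial.T_add]

theorem substQ_mul (s : ℤ) (f g : PowerSeries NSym) :
    substQ s (f * g) = substQ s f * substQ s g := by
  ext n
  simp only [substQ, PowerSeries.coeff_mk, PowerSeries.coeff_mul, Finset.smul_sum]
  refine Finset.sum_congr rfl fun p hp => ?_
  rw [smul_mul_smul_comm, ← LaurentPolynomial.T_add]
  congr 2
  rw [← mem_antidiagonal.1 hp]
  push_cast
  ring

theorem substQ_one (s : ℤ) : substQ s 1 = 1 := by
  ext n
  simp only [substQ, PowerSeries.coeff_mk, PowerSeries.coeff_one]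
  split_ifs with h
  · subst h; simp [qpow]
  · simp

theorem substQ_substQ (s t : ℤ) (f : PowerSeries NSym) :
    substQ s (substQ t f) = substQ (s + t) f := by
  ext n
  simp only [substQ, PowerSeries.coeff_mk, qpow_smul_qpow_smul]
  congr 2
  ring

theorem substQ_zero (f : PowerSeries NSym) : substQ 0 f = f := by
  ext n
  simp [substQ, qpow]

theorem coeff_zero_substQ (s : ℤ) (f : PowerSeries NSym) :
    PowerSeries.coeff 0 (substQ s f) = PowerSeries.coeff 0 f := by
  simp [substQ, qpow]

theorem substQ_list_prod (s : ℤ) (l : List (PowerSeries NSym)) :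
    substQ s l.prod = (l.map (substQ s)).prod := by
  induction l with
  | nil => simp [substQ_one]
  | cons a l ih => simp [substQ_mul, ih]

/-! ### The series `σ_t([m]_q A)` -/

theorem substQ_sigmaQ (s i : ℤ) : substQ s (sigmaQ i) = sigmaQ (s + i) := by
  ext n
  simp only [substQ, sigmaQ, PowerSeries.coeff_mk, qpow_smul_qpow_smul]
  congr 2
  ring

theorem PowerSeries.isUnit_of_coeff_zero_eq_one {R : Type*} [Ring R] {f : PowerSeries R}
    (h : PowerSeries.coeff 0 f = 1) : IsUnit f := by
  have h' : PowerSeries.constantCoeff f = ((1 : Rˣ) : R) := by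
    simpa [PowerSeries.coeff_zero_eq_constantCoeff_apply] using h
  exact ⟨⟨f, f.invOfUnit 1, f.mul_invOfUnit 1 h', f.invOfUnit_mul 1 h'⟩, rfl⟩

theorem coeff_zero_sigmaQ (i : ℤ) : PowerSeries.coeff 0 (sigmaQ i) = 1 := by
  simp [sigmaQ, completeS, qpow]

theorem isUnit_sigmaQ (i : ℤ) : IsUnit (sigmaQ i) :=
  PowerSeries.isUnit_of_coeff_zero_eq_one (coeff_zero_sigmaQ i)

theorem sigmaBracket_natCast (m : ℕ) :
    sigmaBracket m = ((List.range m).map fun i : ℕ => sigmaQ i).prod := rfl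

theorem sigmaBracket_zero : sigmaBracket 0 = 1 := rfl

theorem isUnit_list_map_sigmaQ (l : List ℕ) (f : ℕ → ℤ) :
    IsUnit (l.map fun i => sigmaQ (f i)).prod := by
  induction l with
  | nil => simp
  | cons a l ih => simpa using (isUnit_sigmaQ (f a)).mul ih

theorem Ring.inverse_mul_of_isUnit {M : Type*} [MonoidWithZero M] {a b : M}
    (ha : IsUnit a) (hb : IsUnit b) : Ring.inverse (a * b) = Ring.inverse b * Ring.inverse a := by
  obtain ⟨u, rfl⟩ := ha
  obtain ⟨v, rfl⟩ := hb
  rw [← Units.val_mul, Ring.inverse_unit, Ring.inverse_unit, Ring.inverse_unit, mul_inv_rev,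
    Units.val_mul]

theorem sigmaBracket_neg (p : ℕ) :
    sigmaBracket (-(p : ℤ)) =
      Ring.inverse ((List.range p).map fun i : ℕ => sigmaQ ((i : ℤ) - p)).prod := by
  cases p with
  | zero => simp [sigmaBracket_zero]
  | succ m =>
    rw [show (-((m + 1 : ℕ) : ℤ)) = Int.negSucc m from rfl]
    simp [sigmaBracket]

theorem sigmaBracket_add_one (m : ℤ) : sigmaBracket (m + 1) = sigmaBracket m * sigmaQ m := by
  rcases le_or_gt 0 m with h | h
  · lift m to ℕ using h
    rw [← Nat.cast_succ, sigmaBracket_natCast, sigmaBracket_natCast, List.range_succ]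
    simp
  -- The first factor of the product defining the bracket at `m` is `σ_t(q^m A)`. Inversion reverses
  -- the order, so its inverse stands last and cancels against `sigmaQ m`.
  · obtain ⟨p, rfl⟩ : ∃ p : ℕ, m = -((p + 1 : ℕ) : ℤ) := ⟨(-m - 1).toNat, by omega⟩
    rw [show -((p + 1 : ℕ) : ℤ) + 1 = -(p : ℤ) by push_cast; ring, sigmaBracket_neg,
      sigmaBracket_neg, List.range_succ_eq_map, List.map_cons, List.map_map, List.prod_cons]
    have e : ((fun i : ℕ => sigmaQ ((i : ℤ) - ((p + 1 : ℕ) : ℤ))) ∘ Nat.succ) =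
        fun i : ℕ => sigmaQ ((i : ℤ) - p) := by
      funext i
      simp only [Function.comp_apply]
      congr 1
      push_cast
      ring
    rw [e, Ring.inverse_mul_of_isUnit (isUnit_sigmaQ _) (isUnit_list_map_sigmaQ _ _), mul_assoc]
    rw [Nat.cast_zero, zero_sub, Ring.inverse_mul_cancel _ (isUnit_sigmaQ _), mul_one]

/-- This is `[c + m]_q = [c]_q + q^c [m]_q`, valid for all signs because the one-step recursion is,
and because each factor `sigmaQ` can be cancelled. -/
theorem sigmaBracket_add (c m : ℤ) :
    sigmaBracket (c + m) = sigmaBracket c * substQ c (sigmaBracket m) := by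
  induction m using Int.induction_on with
  | zero => simp [sigmaBracket_zero, substQ_one]
  | succ i ih =>
    rw [← add_assoc, sigmaBracket_add_one, ih, sigmaBracket_add_one, substQ_mul, substQ_sigmaQ,
      mul_assoc]
  | pred i ih =>
    apply (isUnit_sigmaQ (c + (-(i : ℤ) - 1))).mul_right_cancel
    rw [← sigmaBracket_add_one, mul_assoc, ← substQ_sigmaQ, ← substQ_mul, ← sigmaBracket_add_one,
      ← add_sub_assoc, sub_add_cancel, sub_add_cancel, ih]

theorem coeff_zero_sigmaBracket (m : ℤ) : PowerSeries.coeff 0 (sigmaBracket m) = 1 := by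
  have step : ∀ m, PowerSeries.coeff 0 (sigmaBracket (m + 1)) =
      PowerSeries.coeff 0 (sigmaBracket m) := by
    intro m
    rw [sigmaBracket_add_one, PowerSeries.coeff_mul, Finset.Nat.antidiagonal_zero,
      Finset.sum_singleton, coeff_zero_sigmaQ, mul_one]
  induction m using Int.induction_on with
  | zero => simp [sigmaBracket_zero]
  | succ i ih => rw [step, ih]
  | pred i ih => rw [← step, sub_add_cancel, ih]

theorem isUnit_substQ_parkingF (s : ℤ) (k : ℕ) (r : ℤ) : IsUnit (substQ s (parkingF k r)) := by
  apply PowerSeries.isUnit_of_coeff_zero_eq_one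
  rw [coeff_zero_substQ]
  simp only [parkingF, completeBracket, PowerSeries.coeff_mk, coeff_zero_sigmaBracket]
  simp [qpow]

/-! ### Extending a triangular expansion from large `L` to all integers -/

/-- If `σ_t([c_N]_q A)` and `∑ t^n P_n σ_t(q^{c_n} [c_N - c_n]_q A)` have the same coefficient of
`t^N` for all `N`, then `σ_t([L]_q A) = ∑ t^n P_n σ_t(q^{c_n} [L - c_n]_q A)` for all `L`. -/
theorem coeff_sigmaBracket_eq_sum {P : ℕ → NSym} {c : ℕ → ℤ}
    (h : ∀ N, PowerSeries.coeff N (sigmaBracket (c N)) =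
      ∑ p ∈ antidiagonal N,
        P p.1 * PowerSeries.coeff p.2 (substQ (c p.1) (sigmaBracket (c N - c p.1))))
    (L : ℤ) (N : ℕ) :
    PowerSeries.coeff N (sigmaBracket L) =
      ∑ p ∈ antidiagonal N,
        P p.1 * PowerSeries.coeff p.2 (substQ (c p.1) (sigmaBracket (L - c p.1))) := by
  set B : ℤ → PowerSeries NSym := fun L => PowerSeries.mk fun N =>
    ∑ p ∈ antidiagonal N,
      P p.1 * PowerSeries.coeff p.2 (substQ (c p.1) (sigmaBracket (L - c p.1))) with hB
  -- `B` obeys the same cocycle rule as `sigmaBracket`: in each summand the shifts `c n` and `L - c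
  -- n` add up to `L`, so the right factor does not depend on `n`.
  have hadd : ∀ L M, B (L + M) = B L * substQ L (sigmaBracket M) := by
    intro L M
    ext N
    have e : ∀ n, substQ (c n) (sigmaBracket (L + M - c n)) =
        substQ (c n) (sigmaBracket (L - c n)) * substQ L (sigmaBracket M) := by
      intro n
      rw [show L + M - c n = (L - c n) + M by ring, sigmaBracket_add, substQ_mul, substQ_substQ,
        add_sub_cancel]
    simp only [hB, PowerSeries.coeff_mk, PowerSeries.coeff_mul, e, Finset.mul_sum, Finset.sum_mul]
    simp only [Finset.sum_sigma']
    refine Finset.sum_nbij' (fun x => ⟨(x.1.1 + x.2.1, x.2.2), (x.1.1, x.2.1)⟩)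
      (fun x => ⟨(x.2.1, x.2.2 + x.1.2), (x.2.2, x.1.2)⟩) ?_ ?_ ?_ ?_ ?_
    · rintro ⟨⟨a, b⟩, ⟨d, e⟩⟩ hx
      simp only [Finset.mem_sigma, mem_antidiagonal] at hx ⊢
      grind
    · rintro ⟨⟨a, b⟩, ⟨d, e⟩⟩ hx
      simp only [Finset.mem_sigma, mem_antidiagonal] at hx ⊢
      grind
    · rintro ⟨⟨a, b⟩, ⟨d, e⟩⟩ hx
      simp only [Finset.mem_sigma, mem_antidiagonal] at hx
      obtain ⟨rfl, rfl⟩ := hx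
      rfl
    · rintro ⟨⟨a, b⟩, ⟨d, e⟩⟩ hx
      simp only [Finset.mem_sigma, mem_antidiagonal] at hx
      obtain ⟨rfl, rfl⟩ := hx
      rfl
    · rintro ⟨⟨a, b⟩, ⟨d, e⟩⟩ hx
      rw [mul_assoc]
  suffices ∀ N L, PowerSeries.coeff N (B L) = PowerSeries.coeff N (sigmaBracket L) by
    rw [← this N L, hB, PowerSeries.coeff_mk]
  intro N
  induction N using Nat.strong_induction_on with
  | _ N ih =>
    intro L
    -- Starting from `c N`, the coefficients of degree below `N` agree by induction, and the
    -- remaining one, of degree `N` at `c N`, is the hypothesis.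
    rw [show L = c N + (L - c N) by ring, hadd, sigmaBracket_add, PowerSeries.coeff_mul,
      PowerSeries.coeff_mul]
    refine Finset.sum_congr rfl fun p hp => ?_
    rcases (show p.1 ≤ N by have := mem_antidiagonal.1 hp; omega).lt_or_eq with hlt | heq
    · rw [ih _ hlt]
    · rw [heq, h N, hB, PowerSeries.coeff_mk]

/-! ### Passage from the brackets to the series `F` -/

theorem choose_two_add (a b : ℕ) :
    (a + b + 1).choose 2 = (a + 1).choose 2 + (b + 1).choose 2 + a * b := by
  have e : ∀ n : ℕ, (n + 1).choose 2 = ∑ i ∈ Finset.range (n + 1), i := fun n => by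
    rw [Finset.sum_range_id, Nat.choose_two_right]
  have e2 : ∀ n : ℕ, (n + 1).choose 2 * 2 = (n + 1) * n := fun n => by
    rw [e, Finset.sum_range_id_mul_two, Nat.add_sub_cancel]
  have h1 := e2 (a + b)
  have h2 := e2 a
  have h3 := e2 b
  nlinarith

/-- The expansion is used in degree `N` with `L = Nk + r`. For `N = a + b`, the shift contributes
`q^{(l + ak)b}`; the cross term `ab` of `choose_two_add` absorbs `q^{kab}`, and the remaining
`q^{lb}` is the substitution `x ↦ q^l x`. -/
theorem mk_qpow_smul_mul_substQ_parkingF {P : ℕ → NSym} {k l : ℕ} {r : ℤ}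
    (h : ∀ (L : ℤ) (N : ℕ), PowerSeries.coeff N (sigmaBracket L) =
      ∑ p ∈ antidiagonal N, P p.1 * PowerSeries.coeff p.2
        (substQ ((l : ℤ) + p.1 * k) (sigmaBracket (L - ((l : ℤ) + p.1 * k))))) :
    (PowerSeries.mk fun n : ℕ => qpow (-((k : ℤ) * ((n + 1).choose 2 : ℕ))) • P n) *
      substQ l (parkingF k (r - l)) = parkingF k r := by
  ext N
  simp only [parkingF, completeBracket, PowerSeries.coeff_mk, PowerSeries.coeff_mul]
  rw [h, Finset.smul_sum]
  refine Finset.sum_congr rfl fun p hp => ?_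
  obtain ⟨a, b⟩ := p
  rw [mem_antidiagonal] at hp
  subst hp
  simp only [substQ, PowerSeries.coeff_mk, qpow_smul_qpow_smul]
  rw [smul_mul_smul_comm, ← LaurentPolynomial.T_add, mul_smul_comm, qpow_smul_qpow_smul,
    choose_two_add]
  congr 2
  · push_cast; ring
  · rw [show ((b : ℤ) * k + (r - l)) = ((a + b : ℕ) : ℤ) * k + r - (l + (a : ℤ) * k) by
      push_cast; ring]

/-! ### Möbius inversion over descent sets -/

theorem Finset.sum_powerset_sum_powerset_neg_one_pow {α R : Type*} [DecidableEq α] [Ring R]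
    (A : Finset α) (f : Finset α → R) :
    ∑ I ∈ A.powerset, ∑ J ∈ I.powerset, (-1) ^ (I.card + J.card) * f J = f A := by
  induction A using Finset.induction_on generalizing f with
  | empty => simp
  | insert a A ha ih =>
    rw [Finset.sum_powerset_insert ha, ← Finset.sum_add_distrib, ← ih fun J => f (insert a J)]
    refine Finset.sum_congr rfl fun I hI => ?_
    have haI : a ∉ I := fun h => ha (Finset.mem_powerset.1 hI h)
    -- Subsets `J` avoiding `a` occur under both `I` and `insert a I` with opposite signs and
    -- cancel; only the pairs where both sets contain `a` remain.
    rw [Finset.sum_powerset_insert haI, ← add_assoc, ← Finset.sum_add_distrib]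
    rw [Finset.sum_eq_zero, zero_add]
    · refine Finset.sum_congr rfl fun J hJ => ?_
      have haJ : a ∉ J := fun h => haI (Finset.mem_powerset.1 hJ h)
      rw [Finset.card_insert_of_notMem haI, Finset.card_insert_of_notMem haJ,
        show I.card + 1 + (J.card + 1) = I.card + J.card + 2 by ring, pow_add]
      simp
    · intro J hJ
      rw [Finset.card_insert_of_notMem haI, show I.card + 1 + J.card = I.card + J.card + 1 by ring,
        pow_succ]
      simp

/-- Compositions of `n` correspond to subsets of `{1, …, n - 1}`. -/
def descentEquiv (n : ℕ) : Composition n ≃ Finset (Fin (n - 1)) :=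
  (compositionEquiv n).trans (compositionAsSetEquiv n)

theorem descentEquiv_apply {n : ℕ} (I : Composition n) : descentEquiv n I = compDescents I := rfl

theorem mem_compDescents_iff_mem_boundaries {n : ℕ} {I : Composition n} {i : Fin (n - 1)} :
    i ∈ compDescents I ↔ (⟨1 + (i : ℕ), by omega⟩ : Fin (n + 1)) ∈ I.boundaries := by
  simp [compDescents, compositionAsSetEquiv, compositionEquiv, Composition.toCompositionAsSet]

theorem mem_compDescents {n : ℕ} {I : Composition n} {i : Fin (n - 1)} :
    i ∈ compDescents I ↔ ∃ j, (I.blocks.take j).sum = i + 1 := by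
  rw [mem_compDescents_iff_mem_boundaries, ← I.toCompositionAsSet_boundaries,
    CompositionAsSet.mem_boundaries_iff_exists_blocks_sum_take_eq, I.toCompositionAsSet_blocks]
  constructor
  · rintro ⟨j, -, hj⟩
    exact ⟨j, by rw [hj]; simp [add_comm]⟩
  · rintro ⟨j, hj⟩
    refine ⟨j, ?_, by rw [hj]; simp [add_comm]⟩
    rw [I.toCompositionAsSet_boundaries, I.card_boundaries_eq_succ_length]
    -- A prefix longer than the whole list sums to `n`, which is not of the form `i + 1` with `i < n
    -- - 1`.
    by_contra hlt
    rw [List.take_of_length_le (by rw [I.blocks_length]; omega), I.blocks_sum] at hj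
    omega

theorem card_compDescents {n : ℕ} (I : Composition n) :
    (compDescents I).card = I.length - 1 := by
  rcases Nat.eq_zero_or_pos n with rfl | hn
  · have h1 := I.length_le
    have h2 := (compDescents I).card_le_univ
    simp at h2
    simp [h2]
    omega
  · have hb : I.boundaries = insert 0 (insert (Fin.last n) ((compDescents I).image
        fun i : Fin (n - 1) => (⟨1 + (i : ℕ), by omega⟩ : Fin (n + 1)))) := by
      ext x
      simp only [Finset.mem_insert, Finset.mem_image, mem_compDescents_iff_mem_boundaries]
      constructor
      · intro hx
        by_cases h0 : x = 0
        · exact Or.inl h0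
        by_cases h1 : x = Fin.last n
        · exact Or.inr (Or.inl h1)
        have h0' : (x : ℕ) ≠ 0 := fun h => h0 (Fin.ext h)
        have h1' : (x : ℕ) ≠ n := fun h => h1 (Fin.ext h)
        have hxx : (⟨1 + ((x : ℕ) - 1), by omega⟩ : Fin (n + 1)) = x :=
          Fin.ext (by simp only; omega)
        exact Or.inr (Or.inr ⟨⟨(x : ℕ) - 1, by omega⟩, by rwa [hxx], hxx⟩)
      · rintro (rfl | rfl | ⟨i, hi, rfl⟩)
        · exact I.toCompositionAsSet.zero_mem
        · exact I.toCompositionAsSet.getLast_mem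
        · exact hi
    have hc := I.card_boundaries_eq_succ_length
    rw [hb, Finset.card_insert_of_notMem, Finset.card_insert_of_notMem,
      Finset.card_image_of_injective] at hc
    · omega
    · intro a b hab
      simpa [Fin.ext_iff] using hab
    · simp only [Finset.mem_image, not_exists, not_and, Fin.ext_iff, Fin.val_last]
      intro x _
      omega
    · simp only [Finset.mem_insert, Finset.mem_image, not_or, not_exists, not_and, Fin.ext_iff,
        Fin.val_last, Fin.val_zero]
      exact ⟨by omega, fun x _ => by omega⟩

theorem neg_one_pow_length_add_length {n : ℕ} (I J : Composition n) :
    (-1 : NSym) ^ (I.length + J.length) =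
      (-1) ^ ((descentEquiv n I).card + (descentEquiv n J).card) := by
  rw [descentEquiv_apply, descentEquiv_apply, card_compDescents, card_compDescents]
  rcases Nat.eq_zero_or_pos n with rfl | hn
  · have := I.length_le
    have := J.length_le
    congr 1
    omega
  · have h1 := I.length_pos_iff.2 hn
    have h2 := J.length_pos_iff.2 hn
    rw [show I.length + J.length = I.length - 1 + (J.length - 1) + 2 by omega, pow_add]
    simp

/-- Transported to descent sets, coarser compositions are subsets, and this is Möbius inversion on
the Boolean lattice. -/
theorem sum_ribbonR {n : ℕ} (A : Finset (Fin (n - 1))) :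
    ∑ I : Composition n with compDescents I ⊆ A, ribbonR I =
      completeSI ((descentEquiv n).symm A) := by
  have key : ∀ (B : Finset (Fin (n - 1))) (g : Finset (Fin (n - 1)) → NSym),
      ∑ I : Composition n with compDescents I ⊆ B, g (descentEquiv n I) =
        ∑ C ∈ B.powerset, g C := by
    intro B g
    refine Finset.sum_equiv (descentEquiv n) ?_ fun _ _ => rfl
    intro I
    simp [descentEquiv_apply]
  have e : ∀ I : Composition n, ribbonR I = ∑ C ∈ (descentEquiv n I).powerset,
      (-1) ^ ((descentEquiv n I).card + C.card) * completeSI ((descentEquiv n).symm C) := by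
    intro I
    rw [← key, ribbonR]
    refine Finset.sum_congr rfl fun J _ => ?_
    rw [neg_one_pow_length_add_length, Equiv.symm_apply_apply]
  simp_rw [e]
  rw [key A fun D => ∑ C ∈ D.powerset,
      (-1) ^ (D.card + C.card) * completeSI ((descentEquiv n).symm C)]
  exact Finset.sum_powerset_sum_powerset_neg_one_pow A
    fun C => completeSI ((descentEquiv n).symm C)

/-! ### The complete function attached to a nondecreasing word -/

/-- The positions `i` with `w_i < w_{i+1}`. -/
def ascents {n : ℕ} (w : Fin n → ℕ) : Finset (Fin (n - 1)) :=
  {i | w (posL i) < w (posR i)}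

/-- The multiplicity of the letter `j + 1` in a word. -/
def wordMult {n : ℕ} (w : Fin n → ℕ) (j : ℕ) : ℕ :=
  (Finset.univ.filter fun p => w p = j + 1).card

/-- The positions with letter at most `c` form an initial segment. This converts bounds on letters
into bounds on partial sums of multiplicities. -/
theorem Monotone.le_iff_lt_card {n : ℕ} {w : Fin n → ℕ} (hw : Monotone w) (p : Fin n) (c : ℕ) :
    w p ≤ c ↔ (p : ℕ) < (Finset.univ.filter fun q => w q ≤ c).card := by
  constructor
  · intro h
    have : Finset.Iic p ⊆ Finset.univ.filter fun q => w q ≤ c := by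
      intro q hq
      simpa using (hw (Finset.mem_Iic.1 hq)).trans h
    have := Finset.card_le_card this
    rw [Fin.card_Iic] at this
    omega
  · intro h
    by_contra hc
    have : (Finset.univ.filter fun q => w q ≤ c) ⊆ Finset.Iio p := by
      intro q hq
      rw [Finset.mem_filter] at hq
      rw [Finset.mem_Iio]
      by_contra hpq
      exact hc ((hw (not_lt.1 hpq)).trans hq.2)
    have := Finset.card_le_card this
    rw [Fin.card_Iio] at this
    omega

theorem sum_range_wordMult {n : ℕ} {w : Fin n → ℕ} (hw : ∀ p, 1 ≤ w p) (c : ℕ) :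
    ∑ j ∈ Finset.range c, wordMult w j = (Finset.univ.filter fun q => w q ≤ c).card := by
  rw [Finset.card_eq_sum_card_fiberwise (f := fun q => w q - 1) (t := Finset.range c)]
  · refine Finset.sum_congr rfl fun j hj => ?_
    rw [Finset.mem_range] at hj
    rw [wordMult, Finset.filter_filter]
    congr 1
    ext q
    have := hw q
    simp only [Finset.mem_filter, Finset.mem_univ, true_and]
    omega
  · intro q hq
    have := hw q
    simp only [Finset.coe_filter, Finset.mem_univ, true_and, Set.mem_ofPred_eq, Finset.coe_range,
      Set.mem_Iio] at hq ⊢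
    omega

/-- Zero entries only repeat a partial sum. -/
theorem List.exists_sum_take_filter_ne_zero (b : List ℕ) (x : ℕ) :
    (∃ j, ((b.filter (· ≠ 0)).take j).sum = x) ↔ ∃ j, (b.take j).sum = x := by
  induction b generalizing x with
  | nil => simp
  | cons a b ih =>
    have hcons : ∀ (c : List ℕ) (x : ℕ), (∃ j, ((a :: c).take j).sum = x) ↔
        x = 0 ∨ ∃ y, (∃ j, (c.take j).sum = y) ∧ a + y = x := by
      intro c x
      constructor
      · rintro ⟨j, hj⟩
        cases j with
        | zero => left; simpa using hj.symm
        | succ j => exact Or.inr ⟨_, ⟨j, rfl⟩, by simpa using hj⟩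
      · rintro (rfl | ⟨y, ⟨j, rfl⟩, rfl⟩)
        · exact ⟨0, by simp⟩
        · exact ⟨j + 1, by simp⟩
    rw [hcons]
    by_cases ha : a = 0
    · subst ha
      rw [List.filter_cons_of_neg (by simp)]
      simp only [ih, zero_add, exists_eq_right]
      exact ⟨Or.inr, fun h => h.elim (fun h => ⟨0, by simp [h]⟩) id⟩
    · rw [List.filter_cons_of_pos (by simpa using ha), hcons]
      simp only [ih]

theorem completeS_zero : completeS 0 = 1 := by simp [completeS]

theorem List.prod_map_completeS_filter (b : List ℕ) :
    ((b.filter (· ≠ 0)).map completeS).prod = (b.map completeS).prod := by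
  induction b with
  | nil => simp
  | cons a b ih =>
    by_cases ha : a = 0
    · subst ha
      rw [List.filter_cons_of_neg (by simp), ih]
      simp [completeS_zero]
    · rw [List.filter_cons_of_pos (by simpa using ha), List.map_cons,
        List.map_cons, List.prod_cons, List.prod_cons, ih]

/-- A nondecreasing word ascends exactly where one run of equal letters ends and the next begins, so
its ascents are the partial sums of the multiplicities. Absent letters are harmless because `S_0 =
1`. -/
theorem completeSI_ascents {n L : ℕ} {w : Fin n → ℕ} (hmono : Monotone w) (h1 : ∀ p, 1 ≤ w p)
    (hL : ∀ p, w p ≤ L) :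
    completeSI ((descentEquiv n).symm (ascents w)) =
      ((List.range L).map fun j => completeS (wordMult w j)).prod := by
  set b := (List.range L).map (wordMult w) with hb
  have htake : ∀ j, (b.take j).sum =
      (Finset.univ.filter fun q => w q ≤ min j L).card := by
    intro j
    rw [hb, ← List.map_take, List.take_range, ← sum_range_wordMult h1]
    rfl
  have hsum : (b.filter (· ≠ 0)).sum = n := by
    have hbs : b.sum = n := by
      have := htake b.length
      rw [List.take_length, hb, List.length_map, List.length_range, min_self,
        Finset.filter_true_of_mem fun q _ => hL q, Finset.card_univ, Fintype.card_fin] at this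
      exact this
    rw [← hbs]
    generalize b = b'
    induction b' with
    | nil => simp
    | cons a c ih => by_cases ha : a = 0 <;> simp_all
  set I : Composition n := ⟨b.filter (· ≠ 0), fun {i} hi => by
    simpa [Nat.pos_iff_ne_zero] using (List.mem_filter.1 hi).2, hsum⟩ with hI
  have hD : descentEquiv n I = ascents w := by
    ext i
    rw [descentEquiv_apply, mem_compDescents, hI, List.exists_sum_take_filter_ne_zero]
    simp only [htake, ascents, Finset.mem_filter, Finset.mem_univ, true_and]
    constructor
    · rintro ⟨j, hj⟩
      have hl := (hmono.le_iff_lt_card (posL i) (min j L)).2 (by rw [hj]; simp [posL])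
      have hr := mt (hmono.le_iff_lt_card (posR i) (min j L)).1 (by rw [hj]; simp [posR])
      omega
    · intro hlt
      -- All letters up to `w (posL i)` fill exactly the positions through `posL i`, as the next
      -- letter is larger.
      refine ⟨w (posL i), ?_⟩
      rw [min_eq_left (hL _)]
      have hl := (hmono.le_iff_lt_card (posL i) (w (posL i))).1 le_rfl
      have hr := mt (hmono.le_iff_lt_card (posR i) (w (posL i))).2 (by omega)
      simp only [posL, posR] at hl hr ⊢
      omega
  rw [← hD, Equiv.symm_apply_apply, completeSI, hI, List.prod_map_completeS_filter, hb,
    List.map_map]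
  rfl

/-! ### Homomorphisms from a permutational module to a simple module -/

theorem heckeChar_heckeT {n : ℕ} (D : Finset (Fin (n - 1))) (i : Fin (n - 1)) :
    heckeChar n D (heckeT n i) = if i ∈ D then -1 else 0 := by
  simp [heckeChar, heckeT]

theorem mem_homToSimple_iff {n : ℕ} {M : Type*} [AddCommGroup M] [Module ℂ M]
    [Module (HeckeZero n)ᵐᵒᵖ M] [IsScalarTower ℂ (HeckeZero n)ᵐᵒᵖ M]
    {D : Finset (Fin (n - 1))} {f : Module.Dual ℂ M} :
    f ∈ homToSimple n M D ↔ ∀ (i : Fin (n - 1)) (x : M),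
      f (MulOpposite.op (heckeT n i) • x) = (if i ∈ D then -1 else 0) * f x := by
  constructor
  · intro hf i x
    rw [← heckeChar_heckeT D i]
    exact hf _ x
  · intro hf h
    obtain ⟨a, rfl⟩ := RingQuot.mkAlgHom_surjective ℂ (HeckeZeroRel n) h
    induction a using FreeAlgebra.induction with
    | grade0 r =>
      intro x
      rw [AlgHom.commutes, AlgHom.commutes, Algebra.algebraMap_eq_smul_one, MulOpposite.op_smul,
        MulOpposite.op_one, smul_assoc, one_smul, map_smul]
      simp
    | grade1 i =>
      intro x
      have := hf i x
      rw [← heckeChar_heckeT D i] at this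
      exact this
    | mul a b ha hb =>
      intro x
      rw [map_mul, map_mul, MulOpposite.op_mul, mul_smul, hb, ha]
      ring
    | add a b ha hb =>
      intro x
      rw [map_add, map_add, MulOpposite.op_add, add_smul, map_add, ha, hb]
      ring

/-- A word of `W` as an element of the permutational module on `W`. -/
def permBasis {n : ℕ} {W : Set (Fin n → ℕ)} (hW : RearrangementStable W) (w : W) :
    permModule W hW :=
  ⟨wordBasis w, Submodule.subset_span ⟨w, w.2, rfl⟩⟩

theorem permModule_hom_ext {n : ℕ} {W : Set (Fin n → ℕ)} {hW : RearrangementStable W}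
    {f g : permModule W hW →ₗ[ℂ] ℂ} (h : ∀ w, f (permBasis hW w) = g (permBasis hW w)) :
    f = g := by
  ext ⟨x, hx⟩
  have hx' : x ∈ Submodule.span ℂ (wordBasis '' W) := hx
  induction hx' using Submodule.span_induction with
  | mem x h' =>
    obtain ⟨w, hw, rfl⟩ := h'
    exact h ⟨w, hw⟩
  | zero => exact (map_zero f).trans (map_zero g).symm
  | add x y hx1 hy1 h1 h2 =>
    replace hx1 : x ∈ permModule W hW := hx1
    replace hy1 : y ∈ permModule W hW := hy1
    have e : (⟨x + y, hx⟩ : permModule W hW) = ⟨x, hx1⟩ + ⟨y, hy1⟩ := rfl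
    rw [e, map_add, map_add, h1, h2]
  | smul c x hx1 h1 =>
    replace hx1 : x ∈ permModule W hW := hx1
    have e : (⟨c • x, hx⟩ : permModule W hW) = c • ⟨x, hx1⟩ := rfl
    rw [e, map_smul, map_smul, h1]

/-- The linear form on the permutational module with given values on words. -/
def permForm {n : ℕ} {W : Set (Fin n → ℕ)} (hW : RearrangementStable W) (F : (Fin n → ℕ) → ℂ) :
    permModule W hW →ₗ[ℂ] ℂ :=
  LinearMap.comp (Finsupp.linearCombination ℂ F : WordModule n →ₗ[ℂ] ℂ)
    ((permModule W hW).subtype.restrictScalars ℂ)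

theorem permForm_apply {n : ℕ} {W : Set (Fin n → ℕ)} (hW : RearrangementStable W)
    (F : (Fin n → ℕ) → ℂ) (x : permModule W hW) (w : Fin n → ℕ)
    (hx : (x : WordModule n) = wordBasis w) :
    permForm hW F x = F w := by
  change (Finsupp.linearCombination ℂ F : WordModule n →ₗ[ℂ] ℂ) (x : WordModule n) = F w
  rw [hx]
  unfold wordBasis
  erw [Finsupp.linearCombination_single]
  exact one_smul _ _

theorem swapAt_mem {n : ℕ} {W : Set (Fin n → ℕ)} (hW : RearrangementStable W) (i : Fin (n - 1))
    {w : Fin n → ℕ} (hw : w ∈ W) : swapAt i w ∈ W := hW w hw _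

theorem swapAt_swapAt {n : ℕ} (i : Fin (n - 1)) (w : Fin n → ℕ) : swapAt i (swapAt i w) = w := by
  funext p
  simp [swapAt]

theorem heckeT_smul_permBasis_of_lt {n : ℕ} {W : Set (Fin n → ℕ)} {hW : RearrangementStable W}
    {i : Fin (n - 1)} {w : W} (h : w.1 (posL i) < w.1 (posR i)) :
    MulOpposite.op (heckeT n i) • permBasis hW w =
      permBasis hW ⟨swapAt i w.1, swapAt_mem hW i w.2⟩ := by
  apply Subtype.ext
  change MulOpposite.op (heckeT n i) • wordBasis w.1 = wordBasis _
  rw [op_heckeT_smul_wordBasis, wordT, if_pos h]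

theorem heckeT_smul_permBasis_of_eq {n : ℕ} {W : Set (Fin n → ℕ)} {hW : RearrangementStable W}
    {i : Fin (n - 1)} {w : W} (h : w.1 (posL i) = w.1 (posR i)) :
    MulOpposite.op (heckeT n i) • permBasis hW w = 0 := by
  apply Subtype.ext
  change MulOpposite.op (heckeT n i) • wordBasis w.1 = 0
  rw [op_heckeT_smul_wordBasis, wordT, if_neg (by omega), if_pos h]

theorem heckeT_smul_permBasis_of_gt {n : ℕ} {W : Set (Fin n → ℕ)} {hW : RearrangementStable W}
    {i : Fin (n - 1)} {w : W} (h : w.1 (posR i) < w.1 (posL i)) :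
    MulOpposite.op (heckeT n i) • permBasis hW w = (-1 : ℂ) • permBasis hW w := by
  apply Subtype.ext
  change MulOpposite.op (heckeT n i) • wordBasis w.1 = (-1 : ℂ) • wordBasis w.1
  rw [neg_one_smul, op_heckeT_smul_wordBasis, wordT, if_neg (by omega), if_neg (by omega)]

theorem monotone_of_le_posR {n : ℕ} {w : Fin n → ℕ}
    (h : ∀ i : Fin (n - 1), w (posL i) ≤ w (posR i)) : Monotone w := by
  cases n with
  | zero => exact fun a => a.elim0
  | succ m => exact Fin.monotone_iff_le_succ.2 fun i => h i

/-- If a nondecreasing `w` has equal letters at some `i ∈ D`, then `w · T_i = 0` while `f (w · T_i)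
= -f w`, so `f w = 0`. A word with a descent at `i` is `w' · T_i` with `w'` the swapped word, so `f`
there is a multiple of `f w'`. -/
theorem homToSimple_eq_zero {n : ℕ} {W : Set (Fin n → ℕ)} {hW : RearrangementStable W}
    {D : Finset (Fin (n - 1))} {f : Module.Dual ℂ (permModule W hW)}
    (hf : f ∈ homToSimple n (permModule W hW) D)
    (h0 : ∀ w : W, Monotone w.1 → D ⊆ ascents w.1 → f (permBasis hW w) = 0) : f = 0 := by
  rw [mem_homToSimple_iff] at hf
  have hmono : ∀ w : W, Monotone w.1 → f (permBasis hW w) = 0 := by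
    intro w hw
    by_cases hD : D ⊆ ascents w.1
    · exact h0 w hw hD
    · obtain ⟨i, hi, hia⟩ := Finset.not_subset.1 hD
      have hle : w.1 (posL i) ≤ w.1 (posR i) := hw (by simp [posL, posR, Fin.le_def])
      have heq : w.1 (posL i) = w.1 (posR i) :=
        le_antisymm hle (by simpa [ascents] using hia)
      have := hf i (permBasis hW w)
      rw [heckeT_smul_permBasis_of_eq heq, map_zero, if_pos hi] at this
      simpa using this
  have hall : ∀ (u : Lex (Fin n → ℕ)) (hu : ofLex u ∈ W), f (permBasis hW ⟨ofLex u, hu⟩) = 0 := by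
    intro u
    induction u using WellFoundedLT.induction with
    | _ u ih =>
      intro hu
      by_cases hm : Monotone (ofLex u)
      · exact hmono ⟨_, hu⟩ hm
      · obtain ⟨i, hi⟩ : ∃ i : Fin (n - 1), ofLex u (posR i) < ofLex u (posL i) := by
          by_contra hc
          push Not at hc
          exact hm (monotone_of_le_posR hc)
        -- Undoing a descent lowers the word lexicographically, which makes the recursion terminate.
        have hlt : toLex (swapAt i (ofLex u)) < u := by
          refine ⟨posL i, fun j hj => ?_, ?_⟩
          · refine swapAt_of_ne i _ hj.ne (ne_of_lt (hj.trans ?_))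
            simp [posL, posR, Fin.lt_def]
          · simpa [swapAt_posL] using hi
        have hz := ih _ hlt (swapAt_mem hW i hu)
        have := hf i (permBasis hW ⟨swapAt i (ofLex u), swapAt_mem hW i hu⟩)
        rw [heckeT_smul_permBasis_of_lt (by simpa [swapAt_posL, swapAt_posR] using hi)] at this
        simp only [swapAt_swapAt] at this
        rw [this]
        erw [hz]
        simp
  exact permModule_hom_ext fun w => by simpa using hall (toLex w.1) w.2

/-- The factor of a pair `p < q` of positions in `signedBlockProd`. -/
def pairFactor {n : ℕ} (D : Finset (Fin (n - 1))) (p q : Fin n) (a b : ℕ) : ℂ :=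
  open Classical in
  if ∀ r : Fin (n - 1), (p : ℕ) ≤ r → (r : ℕ) < q → r ∈ D then
    if a < b then 1 else if a = b then 0 else -1
  else if a ≤ b then 1 else 0

/-- Cut the positions `1, …, n` into blocks, joining `i` and `i + 1` if `i ∈ D`. The value is `0`
unless no letter exceeds a letter of a later block and the letters of each block are distinct,
and it is then the sign of the word. -/
def signedBlockProd {n : ℕ} (D : Finset (Fin (n - 1))) (w : Fin n → ℕ) : ℂ :=
  ∏ x : Fin n × Fin n with x.1 < x.2, pairFactor D x.1 x.2 (w x.1) (w x.2)

theorem posL_lt_posR {n : ℕ} (i : Fin (n - 1)) : (posL i : Fin n) < posR i := by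
  simp [posL, posR, Fin.lt_def]

theorem signedBlockProd_eq_zero {n : ℕ} {D : Finset (Fin (n - 1))} {w : Fin n → ℕ}
    (i : Fin (n - 1)) (h : pairFactor D (posL i) (posR i) (w (posL i)) (w (posR i)) = 0) :
    signedBlockProd D w = 0 :=
  Finset.prod_eq_zero (i := (posL i, posR i)) (by simp [posL_lt_posR]) h

theorem pairFactor_posL_posR_of_mem {n : ℕ} {D : Finset (Fin (n - 1))} {i : Fin (n - 1)}
    (hi : i ∈ D) (a b : ℕ) :
    pairFactor D (posL i) (posR i) a b = if a < b then 1 else if a = b then 0 else -1 := by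
  rw [pairFactor, if_pos]
  intro r h1 h2
  simp only [posL, posR] at h1 h2
  rwa [show r = i from Fin.ext (by omega)]

theorem signedBlockProd_of_eq {n : ℕ} {D : Finset (Fin (n - 1))} {w : Fin n → ℕ}
    {i : Fin (n - 1)} (hi : i ∈ D) (h : w (posL i) = w (posR i)) : signedBlockProd D w = 0 :=
  signedBlockProd_eq_zero i (by rw [pairFactor_posL_posR_of_mem hi]; simp [h])

theorem signedBlockProd_of_gt {n : ℕ} {D : Finset (Fin (n - 1))} {w : Fin n → ℕ}
    {i : Fin (n - 1)} (hi : i ∉ D) (h : w (posR i) < w (posL i)) : signedBlockProd D w = 0 :=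
  signedBlockProd_eq_zero i (by
    rw [pairFactor, if_neg, if_neg (by omega)]
    intro hc
    exact hi (hc i le_rfl (Nat.lt_succ_self _)))

theorem signedBlockProd_swapAt {n : ℕ} {D : Finset (Fin (n - 1))} {w : Fin n → ℕ}
    {i : Fin (n - 1)} (hi : i ∈ D) (h : w (posL i) < w (posR i)) :
    signedBlockProd D (swapAt i w) = -signedBlockProd D w := by
  have hmem : (posL i, posR i) ∈
      (Finset.univ.filter fun x : Fin n × Fin n => x.1 < x.2) := by simp [posL_lt_posR]
  rw [signedBlockProd, signedBlockProd, ← Finset.mul_prod_erase _ _ hmem,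
    ← Finset.mul_prod_erase _ _ hmem, pairFactor_posL_posR_of_mem hi,
    pairFactor_posL_posR_of_mem hi, swapAt_posL, swapAt_posR, if_neg (by omega),
    if_neg (by omega), if_pos h, neg_one_mul, one_mul, neg_inj]
  -- The pair `(i, i + 1)` has supplied the sign. The transposition permutes the other pairs `p <
  -- q`, and since `i ∈ D` puts both positions in one block, it does not change whether two
  -- positions share a block.
  have hval : ∀ p : Fin n, ((Equiv.swap (posL i) (posR i) p : Fin n) : ℕ) =
      if (p : ℕ) = i then (i : ℕ) + 1 else if (p : ℕ) = i + 1 then (i : ℕ) else p := by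
    intro p
    simp only [Equiv.swap_apply_def, Fin.ext_iff, posL, posR]
    split_ifs <;> rfl
  have himage : ∀ x : Fin n × Fin n,
      x ∈ (Finset.univ.filter fun x : Fin n × Fin n => x.1 < x.2).erase (posL i, posR i) →
      (Equiv.swap (posL i) (posR i) x.1, Equiv.swap (posL i) (posR i) x.2) ∈
        (Finset.univ.filter fun x : Fin n × Fin n => x.1 < x.2).erase (posL i, posR i) := by
    rintro ⟨p, q⟩ hx
    simp only [Finset.mem_erase, Finset.mem_filter, Finset.mem_univ, true_and, ne_eq,
      Prod.mk.injEq, Fin.ext_iff, Fin.lt_def, hval] at hx ⊢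
    simp only [posL, posR] at hx ⊢
    split_ifs <;> omega
  refine Finset.prod_nbij'
    (fun x => (Equiv.swap (posL i) (posR i) x.1, Equiv.swap (posL i) (posR i) x.2))
    (fun x => (Equiv.swap (posL i) (posR i) x.1, Equiv.swap (posL i) (posR i) x.2))
    himage himage (by simp) (by simp) ?_
  rintro ⟨p, q⟩ hx
  simp only [swapAt, Function.comp_apply, pairFactor]
  simp only [Finset.mem_erase, Finset.mem_filter, Finset.mem_univ, true_and, ne_eq,
    Prod.mk.injEq, Fin.ext_iff, Fin.lt_def, posL, posR] at hx
  congr 1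
  apply propext
  simp only [hval]
  constructor
  · intro hc r h1 h2
    by_cases hr : (r : ℕ) = i
    · rwa [show r = i from Fin.ext hr]
    · refine hc r ?_ ?_ <;> split_ifs at h1 h2 <;> omega
  · intro hc r h1 h2
    by_cases hr : (r : ℕ) = i
    · rwa [show r = i from Fin.ext hr]
    · refine hc r ?_ ?_ <;> split_ifs <;> omega

theorem signedBlockProd_of_monotone {n : ℕ} {D : Finset (Fin (n - 1))} {w : Fin n → ℕ}
    (hw : Monotone w) (hD : D ⊆ ascents w) : signedBlockProd D w = 1 := by
  refine Finset.prod_eq_one fun x hx => ?_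
  obtain ⟨p, q⟩ := x
  simp only [Finset.mem_filter, Finset.mem_univ, true_and] at hx
  have hle := hw hx.le
  dsimp only
  unfold pairFactor
  split_ifs with h1 h2
  · rfl
  · exfalso
    have hpq : (p : ℕ) < q := hx
    have hr := hD (h1 ⟨p, by omega⟩ le_rfl hpq)
    simp only [ascents, Finset.mem_filter, Finset.mem_univ, true_and] at hr
    have h4 : w (posR ⟨p, by omega⟩) ≤ w q := hw (by simp only [posR, Fin.le_def]; omega)
    exact absurd (lt_of_lt_of_le hr h4) (by simpa [posL] using h2)
  · exfalso
    omega
  · rfl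

/-- Evaluation at the words of `S` is an isomorphism. It is injective by `homToSimple_eq_zero`. For
surjectivity, prescribed values are extended as a function of the sorted word, then multiplied by
`signedBlockProd`, which has the required behaviour under each `T_i` and equals `1` on `S`. -/
theorem finrank_homToSimple_permModule {n : ℕ} {W : Set (Fin n → ℕ)} (hW : RearrangementStable W)
    (D : Finset (Fin (n - 1))) {S : Finset (Fin n → ℕ)}
    (hS : ∀ v, v ∈ S ↔ v ∈ W ∧ Monotone v ∧ D ⊆ ascents v) :
    Module.finrank ℂ (homToSimple n (permModule W hW) D) = S.card := by
  let Φ : homToSimple n (permModule W hW) D →ₗ[ℂ] (S → ℂ) :=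
    { toFun := fun f v => f.1 (permBasis hW ⟨v, ((hS v).1 v.2).1⟩)
      map_add' := fun _ _ => rfl
      map_smul' := fun _ _ => rfl }
  have hΦ : Function.Bijective Φ := by
    constructor
    · rw [← LinearMap.ker_eq_bot, LinearMap.ker_eq_bot']
      intro f hf
      apply Subtype.ext
      refine homToSimple_eq_zero f.2 fun w hm hD => ?_
      exact congrFun hf ⟨w.1, (hS _).2 ⟨w.2, hm, hD⟩⟩
    · intro g
      set G : (Fin n → ℕ) → ℂ := fun w =>
        if h : w ∘ Tuple.sort w ∈ S then g ⟨_, h⟩ else 0 with hG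
      have hGs : ∀ i w, G (swapAt i w) = G w := by
        intro i w
        have : swapAt i w ∘ Tuple.sort (swapAt i w) = w ∘ Tuple.sort w :=
          Tuple.comp_perm_comp_sort_eq_comp_sort
        simp only [hG, this]
      set F : (Fin n → ℕ) → ℂ := fun w => signedBlockProd D w * G w with hF
      have hmem : permForm hW F ∈ homToSimple n (permModule W hW) D := by
        rw [mem_homToSimple_iff]
        intro i x
        set χ : ℂ := if i ∈ D then -1 else 0 with hχ
        let g₁ : permModule W hW →ₗ[ℂ] ℂ := permForm hW F ∘ₗ
          { toFun := fun x => MulOpposite.op (heckeT n i) • x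
            map_add' := fun x y => smul_add _ x y
            map_smul' := fun c x => smul_comm _ c x }
        let g₂ : permModule W hW →ₗ[ℂ] ℂ := χ • permForm hW F
        suffices g₁ = g₂ from LinearMap.congr_fun this x
        refine permModule_hom_ext fun w => ?_
        change permForm hW F (MulOpposite.op (heckeT n i) • permBasis hW w) =
          χ * permForm hW F (permBasis hW w)
        rw [permForm_apply hW F (permBasis hW w) w.1 rfl]
        rcases lt_trichotomy (w.1 (posL i)) (w.1 (posR i)) with h | h | h
        · rw [heckeT_smul_permBasis_of_lt h, permForm_apply hW F _ (swapAt i w.1) rfl, hF]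
          simp only [hGs]
          by_cases hi : i ∈ D
          · rw [signedBlockProd_swapAt hi h, hχ, if_pos hi]
            ring
          · rw [signedBlockProd_of_gt hi (by simpa [swapAt_posL, swapAt_posR] using h), hχ,
              if_neg hi]
            ring
        · rw [heckeT_smul_permBasis_of_eq h, map_zero, hF]
          by_cases hi : i ∈ D
          · simp [signedBlockProd_of_eq hi h]
          · simp [hχ, hi]
        · rw [heckeT_smul_permBasis_of_gt h, map_smul, permForm_apply hW F _ w.1 rfl, hF]
          by_cases hi : i ∈ D
          · simp [hχ, hi]
          · simp [signedBlockProd_of_gt hi h]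
      refine ⟨⟨permForm hW F, hmem⟩, funext fun v => ?_⟩
      obtain ⟨hvW, hvm, hvD⟩ := (hS v).1 v.2
      change permForm hW F (permBasis hW ⟨v, hvW⟩) = g v
      rw [permForm_apply hW F _ v.1 rfl, hF]
      simp only [signedBlockProd_of_monotone hvm hvD, one_mul, hG]
      have hv : v.1 ∘ Tuple.sort v.1 = v.1 := by
        rw [Tuple.sort_eq_refl_iff_monotone.2 hvm]
        rfl
      simp [hv]
  rw [(LinearEquiv.ofBijective Φ hΦ).finrank_eq, Module.finrank_fintype_fun_eq_card,
    Fintype.card_coe]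

theorem heckeCh_permModule {n : ℕ} {W : Set (Fin n → ℕ)} (hW : RearrangementStable W)
    {S : Finset (Fin n → ℕ)} (hS : ∀ v, v ∈ S ↔ v ∈ W ∧ Monotone v) :
    heckeCh n (permModule W hW) = ∑ v ∈ S, completeSI ((descentEquiv n).symm (ascents v)) := by
  have h : ∀ I : Composition n,
      Module.finrank ℂ (homToSimple n (permModule W hW) (compDescents I)) • ribbonR I =
        ∑ v ∈ S, if compDescents I ⊆ ascents v then ribbonR I else 0 := by
    intro I
    rw [finrank_homToSimple_permModule hW (compDescents I)
      (S := S.filter fun v => compDescents I ⊆ ascents v), ← Finset.sum_filter, Finset.sum_const]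
    intro v
    rw [Finset.mem_filter, hS, and_assoc]
  rw [heckeCh]
  simp_rw [h]
  -- After the exchange, each nondecreasing word collects the ribbons with descent set inside its
  -- ascent set.
  rw [Finset.sum_comm]
  refine Finset.sum_congr rfl fun v _ => ?_
  rw [← Finset.sum_filter, sum_ribbonR]

/-! ### Multiplicity vectors -/

theorem PowerSeries.coeff_list_map_prod {R : Type*} [Semiring R] (f : ℕ → PowerSeries R)
    {l : List ℕ} (hl : l.Nodup) (N : ℕ) :
    PowerSeries.coeff N (l.map f).prod = ∑ m ∈ Finset.piAntidiag l.toFinset N,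
      (l.map fun j => PowerSeries.coeff (m j) (f j)).prod := by
  induction l generalizing N with
  | nil =>
    rw [List.toFinset_nil, Finset.piAntidiag_empty]
    simp only [List.map_nil, List.prod_nil, PowerSeries.coeff_one]
    split_ifs <;> simp
  | cons a l ih =>
    obtain ⟨ha, hl'⟩ := List.nodup_cons.1 hl
    have ha' : a ∉ l.toFinset := by simpa using ha
    rw [List.toFinset_cons, ← Finset.cons_eq_insert _ _ ha', Finset.piAntidiag_cons,
      Finset.sum_disjiUnion, List.map_cons, List.prod_cons, PowerSeries.coeff_mul]
    refine Finset.sum_congr rfl fun p _ => ?_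
    rw [Finset.sum_map, ih hl', Finset.mul_sum]
    refine Finset.sum_congr rfl fun m hm => ?_
    -- `m` is supported on the tail, so the value added at `a` is the whole exponent there and the
    -- tail is unaffected.
    have hma : m a = 0 := by
      by_contra h
      exact ha' ((Finset.mem_piAntidiag.1 hm).2 a h)
    rw [List.map_cons, List.prod_cons]
    congr 1
    · simp [hma]
    · congr 1
      refine List.map_congr_left fun j hj => ?_
      have : j ≠ a := fun h => ha (h ▸ hj)
      simp [this]

/-- The contribution of the letters in a list to `q^{‖w‖} S^I`, where `m` counts letters. -/
def multWeight (l : List ℕ) (m : ℕ → ℕ) : NSym :=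
  (l.map fun j : ℕ => PowerSeries.coeff (m j) (sigmaQ j)).prod

theorem multWeight_append (l l' : List ℕ) (m : ℕ → ℕ) :
    multWeight (l ++ l') m = multWeight l m * multWeight l' m := by
  simp [multWeight]

theorem multWeight_congr {l : List ℕ} {m m' : ℕ → ℕ} (h : ∀ j ∈ l, m j = m' j) :
    multWeight l m = multWeight l m' := by
  unfold multWeight
  congr 1
  exact List.map_congr_left fun j hj => by rw [h j hj]

theorem multWeight_eq_smul (l : List ℕ) (m : ℕ → ℕ) :
    multWeight l m = qpow ((l.map fun j => j * m j).sum : ℕ) •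
      (l.map fun j => completeS (m j)).prod := by
  induction l with
  | nil => simp [multWeight, qpow]
  | cons a l ih =>
    have hcons : multWeight (a :: l) m = multWeight [a] m * multWeight l m :=
      multWeight_append [a] l m
    rw [hcons, ih]
    simp only [multWeight, sigmaQ, PowerSeries.coeff_mk, List.map_cons, List.map_nil,
      List.prod_nil, mul_one, List.prod_cons, List.sum_cons]
    rw [smul_mul_smul_comm, ← LaurentPolynomial.T_add]
    push_cast
    rfl

/-- The letters `a, a + 1, …, a + b - 1`. -/
abbrev shiftedRange (a b : ℕ) : List ℕ := (List.range b).map (a + ·)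

theorem coeff_substQ_sigmaBracket (a b N : ℕ) :
    PowerSeries.coeff N (substQ a (sigmaBracket b)) =
      ∑ m ∈ Finset.piAntidiag (shiftedRange a b).toFinset N, multWeight (shiftedRange a b) m := by
  have hnd : (shiftedRange a b).Nodup :=
    List.Nodup.map (fun x y h => by simpa using h) List.nodup_range
  have := PowerSeries.coeff_list_map_prod (fun j : ℕ => sigmaQ j) hnd N
  rw [sigmaBracket_natCast, substQ_list_prod, List.map_map]
  rw [List.map_map] at this
  refine Eq.trans ?_ this
  congr 3
  funext i
  simp [substQ_sigmaQ]

theorem coeff_sigmaBracket_natCast (b N : ℕ) :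
    PowerSeries.coeff N (sigmaBracket b) =
      ∑ m ∈ Finset.piAntidiag (Finset.range b) N, multWeight (List.range b) m := by
  rw [← substQ_zero (sigmaBracket b), ← Nat.cast_zero, coeff_substQ_sigmaBracket]
  have : (List.range b).toFinset = Finset.range b := by ext; simp
  simp [shiftedRange, this]

/-- The multiplicity vectors of the nondecreasing words of length `n` whose (zero-based) letter
in position `i` is less than `c i`. -/
def parkingMults (c : ℕ → ℕ) (n : ℕ) : Finset (ℕ → ℕ) :=
  {m ∈ Finset.piAntidiag (Finset.range (c n)) n | ∀ i < n, i < ∑ j ∈ Finset.range (c i), m j}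

theorem mem_parkingMults {c : ℕ → ℕ} {n : ℕ} {m : ℕ → ℕ} :
    m ∈ parkingMults c n ↔ (∑ j ∈ Finset.range (c n), m j = n ∧ ∀ j, m j ≠ 0 → j < c n) ∧
      ∀ i < n, i < ∑ j ∈ Finset.range (c i), m j := by
  simp [parkingMults]

/-- The sum of `q^{‖w‖} S^I` over the words with multiplicity vectors in `parkingMults`. -/
def parkingSum (c : ℕ → ℕ) (n : ℕ) : NSym :=
  ∑ m ∈ parkingMults c n, multWeight (List.range (c n)) m

/-- The length of the longest prefix that satisfies the bounds `c`. -/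
def parkingPrefix (c : ℕ → ℕ) (m : ℕ → ℕ) : ℕ :=
  sInf {n | ∑ j ∈ Finset.range (c n), m j ≤ n}

/-! ### Splitting at the longest parking prefix -/

theorem Finset.sum_range_mono (m : ℕ → ℕ) : Monotone fun a => ∑ j ∈ Finset.range a, m j :=
  fun _ _ h => Finset.sum_le_sum_of_subset (Finset.range_mono h)

theorem parkingPrefix_spec {c : ℕ → ℕ} (hc : Monotone c) {m : ℕ → ℕ} {N : ℕ}
    (hm : ∑ j ∈ Finset.range (c N), m j ≤ N) :
    parkingPrefix c m ≤ N ∧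
      ∑ j ∈ Finset.range (c (parkingPrefix c m)), m j = parkingPrefix c m ∧
      ∀ i < parkingPrefix c m, i < ∑ j ∈ Finset.range (c i), m j := by
  have h3 : ∀ i < parkingPrefix c m, i < ∑ j ∈ Finset.range (c i), m j := fun i hi => by
    simpa using Nat.notMem_of_lt_sInf hi
  have h2 : ∑ j ∈ Finset.range (c (parkingPrefix c m)), m j ≤ parkingPrefix c m :=
    Nat.sInf_mem (s := {n | ∑ j ∈ Finset.range (c n), m j ≤ n}) ⟨N, hm⟩
  refine ⟨Nat.sInf_le hm, h2.antisymm ?_, h3⟩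
  rcases Nat.eq_zero_or_pos (parkingPrefix c m) with h0 | h0
  · omega
  -- By minimality, more than `a - 1` letters already lie below `c (a - 1)`, hence at least `a` lie
  -- below `c a`: the infimum is attained with equality.
  · have h4 := h3 (parkingPrefix c m - 1) (by omega)
    have h5 := Finset.sum_range_mono m (hc (Nat.sub_le (parkingPrefix c m) 1))
    simp only at h5
    omega

theorem parkingPrefix_eq {c : ℕ → ℕ} {m : ℕ → ℕ} {a : ℕ}
    (h : ∑ j ∈ Finset.range (c a), m j ≤ a)
    (h' : ∀ i < a, i < ∑ j ∈ Finset.range (c i), m j) : parkingPrefix c m = a := by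
  refine le_antisymm (Nat.sInf_le h) ?_
  by_contra hlt
  have h1 := h' _ (not_le.1 hlt)
  have h2 : ∑ j ∈ Finset.range (c (parkingPrefix c m)), m j ≤ parkingPrefix c m :=
    Nat.sInf_mem (s := {n | ∑ j ∈ Finset.range (c n), m j ≤ n}) ⟨a, h⟩
  omega

/-- The multiplicity vector is cut at the letter `c a`, where `a` is the length of the longest
parking prefix. Exactly `a` letters lie below the cut and they form a parking function. Conversely,
gluing on larger letters leaves the partial sums up to `c a` unchanged, so `a` is recovered. -/
theorem sum_multWeight_eq_sum_antidiagonal {c : ℕ → ℕ} (hc : Monotone c) (N : ℕ) :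
    ∑ m ∈ Finset.piAntidiag (Finset.range (c N)) N, multWeight (List.range (c N)) m =
      ∑ p ∈ antidiagonal N, parkingSum c p.1 *
        ∑ m ∈ Finset.piAntidiag (shiftedRange (c p.1) (c N - c p.1)).toFinset p.2,
          multWeight (shiftedRange (c p.1) (c N - c p.1)) m := by
  simp only [parkingSum, Finset.sum_mul_sum, ← Finset.sum_product']
  rw [Finset.sum_sigma']
  have hshift : ∀ a, a ≤ N → ∀ j,
      (j ∈ (shiftedRange (c a) (c N - c a)).toFinset ↔ c a ≤ j ∧ j < c N) := by
    intro a ha j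
    have := hc ha
    simp only [shiftedRange, List.mem_toFinset, List.mem_map, List.mem_range]
    constructor
    · rintro ⟨x, hx, rfl⟩
      omega
    · rintro ⟨h1, h2⟩
      exact ⟨j - c a, by omega, by omega⟩
  have hsplit : ∀ a, a ≤ N → ∀ m : ℕ → ℕ, ∑ j ∈ Finset.range (c N), m j =
      ∑ j ∈ Finset.range (c a), m j + ∑ j ∈ (shiftedRange (c a) (c N - c a)).toFinset, m j := by
    intro a ha m
    rw [← Finset.sum_range_add_sum_Ico m (hc ha)]
    congr 1
    refine Finset.sum_congr ?_ fun _ _ => rfl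
    ext j
    rw [hshift a ha, Finset.mem_Ico]
  refine Finset.sum_nbij'
    (fun m => ⟨(parkingPrefix c m, N - parkingPrefix c m),
      (fun j => if j < c (parkingPrefix c m) then m j else 0,
        fun j => if j < c (parkingPrefix c m) then 0 else m j)⟩)
    (fun x j => x.2.1 j + x.2.2 j) ?_ ?_ ?_ ?_ ?_
  · intro m hm
    obtain ⟨hm1, hm2⟩ := Finset.mem_piAntidiag.1 hm
    obtain ⟨h1, h2, h3⟩ := parkingPrefix_spec hc hm1.le
    set a := parkingPrefix c m
    simp only [Finset.mem_sigma, mem_antidiagonal, Finset.mem_product, mem_parkingMults,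
      Finset.mem_piAntidiag]
    have hlow : ∀ b, b ≤ c a → ∑ j ∈ Finset.range b, (if j < c a then m j else 0) =
        ∑ j ∈ Finset.range b, m j := by
      intro b hb
      refine Finset.sum_congr rfl fun j hj => ?_
      rw [if_pos ((Finset.mem_range.1 hj).trans_le hb)]
    have hhigh : ∑ j ∈ (shiftedRange (c a) (c N - c a)).toFinset, (if j < c a then 0 else m j) =
        ∑ j ∈ (shiftedRange (c a) (c N - c a)).toFinset, m j := by
      refine Finset.sum_congr rfl fun j hj => ?_
      rw [if_neg (not_lt.2 ((hshift a h1 j).1 hj).1)]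
    refine ⟨by omega, ⟨⟨by rw [hlow _ le_rfl, h2], fun j hj => ?_⟩, fun i hi => ?_⟩, ?_, ?_⟩
    · by_contra h
      exact hj (if_neg h)
    · rw [hlow _ (hc hi.le)]
      exact h3 i hi
    · have := hsplit a h1 m
      rw [h2, hm1] at this
      rw [hhigh]
      omega
    · intro j hj
      by_cases h : j < c a
      · exact absurd (if_pos h) hj
      · rw [if_neg h] at hj
        exact (hshift a h1 j).2 ⟨not_lt.1 h, Finset.mem_range.1 (hm2 j hj)⟩
  · rintro ⟨⟨a, b⟩, ⟨u, w⟩⟩ hx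
    simp only [Finset.mem_sigma, mem_antidiagonal, Finset.mem_product, mem_parkingMults,
      Finset.mem_piAntidiag] at hx
    obtain ⟨hab, ⟨⟨hu1, hu2⟩, hu3⟩, hw1, hw2⟩ := hx
    have haN : a ≤ N := by omega
    rw [Finset.mem_piAntidiag]
    constructor
    · rw [hsplit a haN]
      simp only [Finset.sum_add_distrib]
      rw [hu1, hw1]
      rw [Finset.sum_eq_zero (s := Finset.range (c a)), Finset.sum_eq_zero]
      · omega
      · intro j hj
        by_contra h
        have := ((hshift a haN j).1 hj).1
        have := hu2 j h
        omega
      · intro j hj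
        by_contra h
        have := ((hshift a haN j).1 (hw2 j h)).1
        have := Finset.mem_range.1 hj
        omega
    · intro j hj
      rw [Finset.mem_range]
      by_cases h : u j = 0
      · exact ((hshift a haN j).1 (hw2 j fun h' => hj (by simp [h, h']))).2
      · exact (hu2 j h).trans_le (hc haN)
  · intro m hm
    funext j
    simp only
    split_ifs <;> simp
  · rintro ⟨⟨a, b⟩, ⟨u, w⟩⟩ hx
    simp only [Finset.mem_sigma, mem_antidiagonal, Finset.mem_product, mem_parkingMults,
      Finset.mem_piAntidiag] at hx
    obtain ⟨hab, ⟨⟨hu1, hu2⟩, hu3⟩, hw1, hw2⟩ := hx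
    have haN : a ≤ N := by omega
    have hw0 : ∀ j < c a, w j = 0 := by
      intro j hj
      by_contra h
      exact absurd ((hshift a haN j).1 (hw2 j h)).1 (by omega)
    have hu0 : ∀ j, ¬ j < c a → u j = 0 := by
      intro j hj
      by_contra h
      exact hj (hu2 j h)
    have hsum : ∀ i, i ≤ a → ∑ j ∈ Finset.range (c i), (u j + w j) =
        ∑ j ∈ Finset.range (c i), u j := by
      intro i hi
      refine Finset.sum_congr rfl fun j hj => ?_
      rw [hw0 j ((Finset.mem_range.1 hj).trans_le (hc hi)), add_zero]
    have ha : parkingPrefix c (fun j => u j + w j) = a :=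
      parkingPrefix_eq (by rw [hsum a le_rfl, hu1]) fun i hi => by
        rw [hsum i hi.le]
        exact hu3 i hi
    have hlow : (fun j => if j < c a then u j + w j else 0) = u := by
      funext j
      split_ifs with h
      · rw [hw0 j h, add_zero]
      · rw [hu0 j h]
    have hhigh : (fun j => if j < c a then 0 else u j + w j) = w := by
      funext j
      split_ifs with h
      · rw [hw0 j h]
      · rw [hu0 j h, zero_add]
    simp only [ha, hlow, hhigh]
    rw [show N - a = b by omega]
  · intro m hm
    obtain ⟨hm1, hm2⟩ := Finset.mem_piAntidiag.1 hm
    obtain ⟨h1, h2, h3⟩ := parkingPrefix_spec hc hm1.le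
    set a := parkingPrefix c m
    -- The factors are ordered by letter, so the noncommutative product breaks at the cut with the
    -- prefix on the left.
    have hr : List.range (c N) = List.range (c a) ++ shiftedRange (c a) (c N - c a) := by
      rw [shiftedRange, ← List.range_add, Nat.add_sub_cancel' (hc h1)]
    rw [hr, multWeight_append]
    congr 1
    · refine multWeight_congr fun j hj => ?_
      simp only
      rw [if_pos (List.mem_range.1 hj)]
    · refine multWeight_congr fun j hj => ?_
      simp only
      rw [if_neg (not_lt.2 ((hshift a h1 j).1 (List.mem_toFinset.2 hj)).1)]

theorem coeff_sigmaBracket_eq_sum_parkingSum {c : ℕ → ℕ} (hc : Monotone c) (N : ℕ) :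
    PowerSeries.coeff N (sigmaBracket (c N)) = ∑ p ∈ antidiagonal N, parkingSum c p.1 *
      PowerSeries.coeff p.2 (substQ (c p.1) (sigmaBracket ((c N : ℤ) - c p.1))) := by
  rw [coeff_sigmaBracket_natCast, sum_multWeight_eq_sum_antidiagonal hc]
  refine Finset.sum_congr rfl fun p hp => ?_
  have hle : c p.1 ≤ c N := hc (by have := mem_antidiagonal.1 hp; omega)
  rw [← Nat.cast_sub hle, coeff_substQ_sigmaBracket]

/-! ### Parking functions and their multiplicities -/

/-- The nondecreasing `(k, l)`-parking functions. -/
def sortedParking (k l n : ℕ) : Finset (Fin n → ℕ) :=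
  open Classical in (parkingFunctions k l n).filter Monotone

theorem mem_sortedParking {k l n : ℕ} {v : Fin n → ℕ} :
    v ∈ sortedParking k l n ↔
      Monotone v ∧ (∀ p, 1 ≤ v p) ∧ ∀ i : Fin n, v i ≤ l + i * k := by
  simp only [sortedParking, parkingFunctions, Finset.mem_filter, Fintype.mem_piFinset,
    Finset.mem_Icc]
  constructor
  · rintro ⟨⟨h1, h2⟩, h3⟩
    rw [Tuple.sort_eq_refl_iff_monotone.2 h3] at h2
    exact ⟨h3, fun p => (h1 p).1, h2⟩
  · rintro ⟨h3, h1, h2⟩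
    rw [Tuple.sort_eq_refl_iff_monotone.2 h3]
    refine ⟨⟨fun p => ⟨h1 p, (h2 p).trans ?_⟩, h2⟩, h3⟩
    gcongr
    omega

theorem parkingChq_eq_sum (k l n : ℕ) :
    parkingChq k l n = ∑ v ∈ sortedParking k l n,
      qpow (wordWeight v) • completeSI ((descentEquiv n).symm (ascents v)) := by
  classical
  rw [parkingChq, ← Finset.sum_fiberwise_of_maps_to (s := sortedParking k l n)
    (t := (parkingFunctions k l n).image wordWeight) (g := wordWeight)]
  · refine Finset.sum_congr rfl fun d _ => ?_
    rw [heckeCh_permModule (parkingOfWeight_stable k l n d)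
      (S := (sortedParking k l n).filter fun v => wordWeight v = d), Finset.smul_sum]
    · refine Finset.sum_congr rfl fun v hv => ?_
      rw [(Finset.mem_filter.1 hv).2]
    · intro v
      simp only [sortedParking, parkingOfWeight, Finset.mem_filter, Set.mem_ofPred_eq]
      tauto
  · intro v hv
    exact Finset.mem_image_of_mem _ (Finset.mem_filter.1 hv).1

theorem wordWeight_eq_sum {n L : ℕ} {w : Fin n → ℕ} (h1 : ∀ p, 1 ≤ w p) (hL : ∀ p, w p ≤ L) :
    wordWeight w = ((List.range L).map fun j => j * wordMult w j).sum := by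
  change _ = ∑ j ∈ Finset.range L, j * wordMult w j
  rw [wordWeight, ← Finset.sum_fiberwise_of_maps_to (s := Finset.univ) (t := Finset.range L)
    (g := fun p => w p - 1)]
  · refine Finset.sum_congr rfl fun j _ => ?_
    rw [Finset.sum_congr rfl fun p hp => (Finset.mem_filter.1 hp).2, Finset.sum_const,
      smul_eq_mul, mul_comm, wordMult]
    congr 2
    ext p
    have := h1 p
    simp only [Finset.mem_filter, Finset.mem_univ, true_and]
    omega
  · intro p _
    have := h1 p
    have := hL p
    rw [Finset.mem_range]
    omega

theorem eq_of_sum_range_eq {f g : ℕ → ℕ}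
    (h : ∀ c, ∑ j ∈ Finset.range c, f j = ∑ j ∈ Finset.range c, g j) : f = g := by
  funext j
  have h1 := h (j + 1)
  rw [Finset.sum_range_succ, Finset.sum_range_succ, h j] at h1
  omega

theorem exists_monotone_wordMult_eq {n L : ℕ} {m : ℕ → ℕ}
    (hm : ∑ j ∈ Finset.range L, m j = n) (hL : ∀ j, m j ≠ 0 → j < L) :
    ∃ v : Fin n → ℕ, Monotone v ∧ (∀ p, 1 ≤ v p) ∧ wordMult v = m := by
  have hex : ∀ p : Fin n, ∃ c, (p : ℕ) < ∑ j ∈ Finset.range c, m j :=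
    fun p => ⟨L, by rw [hm]; exact p.2⟩
  -- The word is the generalised inverse of the partial sums. The empty sum at `0` makes every
  -- letter at least `1`.
  set v : Fin n → ℕ := fun p => Nat.find (hex p) with hv
  have hle : ∀ p c, v p ≤ c ↔ (p : ℕ) < ∑ j ∈ Finset.range c, m j := by
    intro p c
    rw [hv, Nat.find_le_iff]
    constructor
    · rintro ⟨a, ha, h⟩
      exact h.trans_le (Finset.sum_range_mono m ha)
    · exact fun h => ⟨c, le_rfl, h⟩
  have h1 : ∀ p, 1 ≤ v p := by
    intro p
    by_contra h
    have := (hle p 0).1 (by omega)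
    simp at this
  refine ⟨v, fun p q hpq => (hle p _).2 (lt_of_le_of_lt hpq ((hle q _).1 le_rfl)), h1, ?_⟩
  refine eq_of_sum_range_eq fun c => ?_
  rw [sum_range_wordMult h1]
  simp only [hle]
  have hn : ∑ j ∈ Finset.range c, m j ≤ n := by
    rw [← hm]
    refine Finset.sum_le_sum_of_ne_zero fun j _ hj => Finset.mem_range.2 (hL j hj)
  exact Fin.card_filter_val_lt.trans (min_eq_right hn)

theorem parkingChq_eq_parkingSum (k l n : ℕ) :
    parkingChq k l n = parkingSum (fun i => l + i * k) n := by
  rw [parkingChq_eq_sum, parkingSum]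
  -- `parkingSum` uses `l + n * k` letters, more than the alphabet of `parkingFunctions` when `n`
  -- and `k` are positive; the surplus letters never occur.
  have hbound : ∀ v ∈ sortedParking k l n, ∀ p, v p ≤ l + n * k := by
    intro v hv p
    refine ((mem_sortedParking.1 hv).2.2 p).trans ?_
    gcongr
    exact p.2.le
  refine Finset.sum_bij (fun v _ => wordMult v) ?_ ?_ ?_ ?_
  · intro v hv
    obtain ⟨h1, h2, h3⟩ := mem_sortedParking.1 hv
    rw [mem_parkingMults]
    refine ⟨⟨?_, fun j hj => ?_⟩, fun i hi => ?_⟩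
    · rw [sum_range_wordMult h2, Finset.filter_true_of_mem fun p _ => hbound v hv p]
      simp
    · obtain ⟨p, hp⟩ := Finset.card_ne_zero.1 hj
      have := (Finset.mem_filter.1 hp).2
      have := hbound v hv p
      omega
    · rw [sum_range_wordMult h2]
      exact (h1.le_iff_lt_card ⟨i, hi⟩ _).1 (h3 ⟨i, hi⟩)
  · intro v hv v' hv' h
    obtain ⟨h1, h2, -⟩ := mem_sortedParking.1 hv
    obtain ⟨h1', h2', -⟩ := mem_sortedParking.1 hv'
    funext p
    refine eq_of_forall_ge_iff fun c => ?_
    rw [h1.le_iff_lt_card, h1'.le_iff_lt_card, ← sum_range_wordMult h2,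
      ← sum_range_wordMult h2', h]
  · intro m hm
    rw [mem_parkingMults] at hm
    obtain ⟨⟨hm1, hm2⟩, hm3⟩ := hm
    obtain ⟨v, h1, h2, rfl⟩ := exists_monotone_wordMult_eq hm1 hm2
    refine ⟨v, mem_sortedParking.2 ⟨h1, h2, fun i => ?_⟩, rfl⟩
    rw [h1.le_iff_lt_card, ← sum_range_wordMult h2]
    exact hm3 i i.2
  · intro v hv
    obtain ⟨h1, h2, -⟩ := mem_sortedParking.1 hv
    rw [multWeight_eq_smul, completeSI_ascents h1 h2 (hbound v hv),
      wordWeight_eq_sum h2 (hbound v hv)]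

end

theorem mainTheorem8 (k l : ℕ) (r : ℤ) :
    IsUnit (substQ l (parkingF k (r - l))) ∧
      (PowerSeries.mk fun n : ℕ =>
          qpow (-((k : ℤ) * ((n + 1).choose 2 : ℕ))) • parkingChq k l n) =
        parkingF k r * Ring.inverse (substQ l (parkingF k (r - l))) := by
  refine ⟨isUnit_substQ_parkingF l k (r - l), ?_⟩
  rw [Ring.eq_mul_inverse_iff_mul_eq _ _ _ (isUnit_substQ_parkingF l k (r - l))]
  apply mk_qpow_smul_mul_substQ_parkingF
  have hc : Monotone fun i => l + i * k := fun a b h => by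
    simp only
    gcongr
  intro L N
  -- The factorisation of words supplies the values at `L = c N`, from which all `L` follow.
  have := coeff_sigmaBracket_eq_sum (P := parkingSum fun i => l + i * k)
    (c := fun i => ((l + i * k : ℕ) : ℤ)) (coeff_sigmaBracket_eq_sum_parkingSum hc) L N
  simpa only [parkingChq_eq_parkingSum, Nat.cast_add, Nat.cast_mul] using this
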